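/- Consider the $\frac{\pi}{4}$-rotated square grid of mesh size $\sqrt2$, whose sites are the points $(a,s)\in\mathbb Z^2$ with $a+s$ even, each site $(a,s)$ having the four neighbours $(a\pm1,s\pm1)$. For a finite set $\Lambda$ of sites, the critical homogeneous Ising model in $\Lambda$ with '$+$' boundary conditions is the probability measure on spin configurations $\sigma$ with $\sigma_u=\pm1$ for $u\in\Lambda$ and $\sigma_u=+1$ for $u\notin\Lambda$ given by $$\mathbb P_\Lambda[\sigma]\ \propto\ \exp\Big[\beta J\sum_{u\sim w,\ \{u,w\}\cap\Lambda\neq\emptyset}\sigma_u\sigma_w\Big],\qquad \exp[-2\beta J]=\tan\tfrac{\theta}{2},\quad \theta=\tfrac{\pi}{4}.$$ For $n\in\mathbb N_0$ let $$D_n\ :=\ \lim_{\Lambda}\ \mathbb E_\Lambda[\sigma_{(-2n,0)}\sigma_{(0,0)}]$$ be the infinite-volume limit, over finite sets $\Lambda$ of sites ordered by inclusion, of the diagonal spin-spin correlation at distance of $n$ diagonal steps. For $m\in\mathbb N_0$ let $$M_m\ :=\ \mathbb E^+_{\mathbb H^\diamond}[\sigma_{(-2m,0)}]\ :=\ \lim_{\Lambda}\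 \mathbb E_\Lambda[\sigma_{(-2m,0)}],$$ the limit now being over finite sets $\Lambda$ of sites $(a,s)$ with $a<0$, ordered by inclusion. This is the magnetization in the $(2m)$-th column of the zig-zag left half-plane $\mathbb H^\diamond=\{(a,s):a\le 0\}$ with '$+$' boundary conditions at its right-most column $\{a=0\}$ (the $0$-th column) and at infinity. Theorem. All these limits exist and, for every $m\in\mathbb N_0$, one has $M_m\neq0$, $D_{2m+1}\neq 0$ and $$\frac{M_{m+1}}{M_m}\ =\ \frac{D_{2m+2}}{D_{2m+1}},\qquad M_m\ =\ \Big(\frac{2}{\pi}\Big)^{m}\ \prod_{k=1}^{2m-1}\Big(1-\frac{1}{4k^2}\Big)^{\lfloor k/2\rfloor-m},$$ where the product is empty (equal to $1$) for $m=0$. -/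

import Mathlib

open Filter Topology

namespace ZigZagIsing

/-- The sites of the `π/4`-rotated square grid of mesh size `√2`: the integer points `(a, s)` with
`a + s` even. The spins of the Ising model live on these sites. -/
abbrev Site : Type := {z : ℤ × ℤ // Even (z.1 + z.2)}

/-- The site `(2j, 0)`. -/
def axisSite (j : ℤ) : Site := ⟨(2 * j, 0), by simp⟩

/-- The rotated square grid: every site `(a, s)` has the four neighbours `(a ± 1, s ± 1)`. -/
def grid : SimpleGraph Site where
  Adj x y := |x.1.1 - y.1.1| = 1 ∧ |x.1.2 - y.1.2| = 1
  symm := ⟨fun x y h => by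
    rw [abs_sub_comm y.1.1, abs_sub_comm y.1.2]
    exact h⟩
  loopless := ⟨fun x h => by simp at h⟩

theorem grid_neighborSet_finite (x : Site) : (grid.neighborSet x).Finite := by
  refine Set.Finite.subset
    (((Set.finite_Icc (x.1.1 - 1) (x.1.1 + 1)).prod
      (Set.finite_Icc (x.1.2 - 1) (x.1.2 + 1))).preimage
        (Subtype.val_injective.injOn : Set.InjOn (Subtype.val : Site → ℤ × ℤ) _)) ?_
  rintro y ⟨h1, h2⟩
  have h1' := abs_le.1 h1.le
  have h2' := abs_le.1 h2.le
  simp only [Set.mem_preimage, Set.mem_prod, Set.mem_Icc]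
  omega

noncomputable instance : grid.LocallyFinite := fun x => (grid_neighborSet_finite x).fintype

/-- The bonds of the grid that have at least one end in `Λ`. -/
noncomputable def bonds (Λ : Finset Site) : Finset (Sym2 Site) := by
  classical exact Λ.biUnion fun x => grid.incidenceFinset x

theorem mem_bonds (Λ : Finset Site) (e : Sym2 Site) :
    e ∈ bonds Λ ↔ e ∈ grid.edgeSet ∧ ∃ x ∈ Λ, x ∈ e := by
  classical
  simp only [bonds, Finset.mem_biUnion, SimpleGraph.mem_incidenceFinset,
    SimpleGraph.incidenceSet, Set.mem_ofPred_eq]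
  tauto

/-- A spin configuration in `Λ`, extended by `+1` outside `Λ` (`+` boundary conditions). -/
noncomputable def plusSpin (Λ : Finset Site) (τ : Λ → ℤˣ) (x : Site) : ℝ := by
  classical exact if h : x ∈ Λ then ((τ ⟨x, h⟩ : ℤ) : ℝ) else 1

/-- The interaction `βJ` given by the parametrization `exp (-2βJ) = tan (θ / 2)`. -/
noncomputable def coupling (θ : ℝ) : ℝ := -(Real.log (Real.tan (θ / 2))) / 2

/-- The Boltzmann weight `exp (βJ ∑ σ_u σ_w)`, the sum being over the bonds `uw` that have at least
one end in `Λ`. -/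
noncomputable def weight (θ : ℝ) (Λ : Finset Site) (τ : Λ → ℤˣ) : ℝ :=
  Real.exp (coupling θ * ∑ e ∈ bonds Λ, (e.map (plusSpin Λ τ)).mul)

/-- The expectation of `f(σ)` in the homogeneous Ising model with parameter `θ` in the finite
domain `Λ` with `+` boundary conditions. -/
noncomputable def plusExp (θ : ℝ) (Λ : Finset Site) (f : (Site → ℝ) → ℝ) : ℝ :=
  (∑ τ : Λ → ℤˣ, f (plusSpin Λ τ) * weight θ Λ τ) / ∑ τ : Λ → ℤˣ, weight θ Λ τ

/-- The critical value of `θ`. -/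
noncomputable def θcrit : ℝ := Real.pi / 4

/-- The diagonal spin-spin correlation at distance of `n` diagonal steps in the critical model in
the finite domain `Λ` of the full plane, with `+` boundary conditions. The site `(a, s)` stands for
the point `(n + 1/2 + a, s)` of the plane, so that the two spins are at `(±n + 1/2, 0)`. -/
noncomputable def diagCorrIn (n : ℕ) (Λ : Finset Site) : ℝ :=
  plusExp θcrit Λ fun σ => σ (axisSite (-n)) * σ (axisSite 0)

/-- `D_n`: the infinite-volume limit of the diagonal spin-spin correlation, along the finite
domains ordered by inclusion. -/
noncomputable def D (n : ℕ) : ℝ := limUnder atTop (diagCorrIn n)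

/-- The sites of the zig-zag left half-plane that are not in its right-most column. The site
`(a, s)` stands for the point `(a - 1/2, s)`, and the column `C_p` is `a = -p`. The half-plane
consists of the columns `C_0, C_1, C_2, …`. -/
abbrev InnerSite : Type := {x : Site // x.1.1 < 0}

/-- The magnetization at the point `(-2m - 1/2, 0)` of the column `C_{2m}` in the critical model in
a finite domain `Λ` of the half-plane, with `+` boundary conditions. All spins outside `Λ` are `+1`,
in particular those of the column `C_0`; sites to the right of `C_0` have no neighbour in `Λ`. -/
noncomputable def magIn (m : ℕ) (Λ : Finset InnerSite) : ℝ :=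
  plusExp θcrit (Λ.map (Function.Embedding.subtype _)) fun σ => σ (axisSite (-m))

/-- `M_m`: the magnetization in the column `C_{2m}` of the zig-zag half-plane with `+` boundary
conditions at the column `C_0` and at infinity, as the limit along the finite domains ordered by
inclusion. -/
noncomputable def M (m : ℕ) : ℝ := limUnder atTop (magIn m)

end ZigZagIsing

/-! Fix a spin at an axis site and a disorder at an axis face, and let a second disorder travel
through the faces of the upper half-plane together with a second spin at a vertex of its face
(`obs`). At criticality `exp (-2βJ x) = √2 - x` for `x = ±1`, so moving the disorder across a bond
gives a linear relation between such correlations (`twistedSum_move`). These relations make the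
correlation with the spin at the right vertex discrete harmonic (`IsSpinor.harmonic`). On the axis,
reflection symmetry (`obs_axis_eq_zero`) confines its boundary values to a finite interval of faces,
where its normal derivative vanishes except at the two ends (`IsSpinor.axis_defect`). Where the two
disorders coincide they cancel and leave spin correlations at consecutive distances, one as a
boundary value and one as a normal derivative.

A bounded harmonic function is determined by its boundary values, and passing to the normal
derivative is convolution with the Fourier coefficients of `|sin t|` (`defect_eq_sum`). Hence the
boundary values solve a finite Toeplitz system whose right-hand side lives at the ends of the
interval. Explicit orthogonal polynomials yield its end unknowns (`toeplitz_last`,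
`toeplitz_first`), with Wallis products `W n` as constants.

In the plane the interval has `n + 1` faces and the system couples `D` to the disorder correlations;
boundedness forces the two to agree, so `D (n + 1) = 2 / π * W n * D n` (`D_succ`). In the
half-plane the `+` column allows an even extension across it (`IsSpinor.evenExtension_harmonic`);
the doubled interval has `2 * m + 2` faces, both ends carry `M (m + 1)`, and the same system with `n
= 2 * m + 1` gives `M (m + 1) = 2 / π * W (2 * m + 1) * M m` (`M_succ`). The ratios agree, and
iteration gives the product. The limits exist by Griffiths monotonicity (`plusExp_antitone`). -/

namespace ZigZagIsing

/-! ### Griffiths inequalities for real characters of a group of exponent two. -/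

section Characters

variable {G : Type*} [CommGroup G]

theorem char_eq_one_or_neg_one (hG : ∀ g : G, g * g = 1) (χ : G →* ℝ) (g : G) :
    χ g = 1 ∨ χ g = -1 := by
  have h : χ g * χ g = 1 := by rw [← map_mul, hG, map_one]
  exact mul_self_eq_one_iff.mp h

variable [Fintype G]

/-- A nontrivial character sums to zero: translation by an element of value `-1` reverses the sign
of the sum. -/
theorem sum_char_nonneg (hG : ∀ g : G, g * g = 1) (χ : G →* ℝ) : 0 ≤ ∑ g, χ g := by
  by_cases h : ∀ g, χ g = 1
  · simp [h]
  · push Not at h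
    obtain ⟨a, ha⟩ := h
    have h1 : χ a = -1 := (char_eq_one_or_neg_one hG χ a).resolve_left ha
    have h2 : ∑ g, χ (a * g) = ∑ g, χ g := Equiv.sum_comp (Equiv.mulLeft a) fun g => χ g
    simp only [map_mul, h1, ← Finset.mul_sum] at h2
    linarith

theorem exp_mul_sign {x : ℝ} (J : ℝ) (hx : x = 1 ∨ x = -1) :
    Real.exp (J * x) = Real.cosh J + x * Real.sinh J := by
  rcases hx with rfl | rfl
  · simp [Real.cosh_add_sinh]
  · have := Real.cosh_sub_sinh J
    simp only [mul_neg, mul_one, ← this]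
    ring

/-- Reversing the signs of some of the couplings of a ferromagnetic Gibbs weight can only decrease
the absolute value of the sum of a character. -/
theorem abs_sum_char_mul_exp_le (hG : ∀ g : G, g * g = 1) {ι : Type*} (s : Finset ι)
    (J ε : ι → ℝ) (hJ : ∀ i ∈ s, 0 ≤ J i) (hε : ∀ i ∈ s, ε i = 1 ∨ ε i = -1)
    (ψ : ι → G →* ℝ) (χ : G →* ℝ) :
    |∑ g, χ g * Real.exp (∑ i ∈ s, J i * (ε i * ψ i g))|
      ≤ ∑ g, χ g * Real.exp (∑ i ∈ s, J i * ψ i g) := by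
  classical
  induction s using Finset.induction_on generalizing χ with
  | empty => simp [abs_of_nonneg (sum_char_nonneg hG χ)]
  | insert a s ha ih =>
    -- By `exp_mul_sign`, splitting off one coupling gives two sums of the same kind, for the
    -- characters `χ` and `χ * ψ a`; the sign `δ a` is the only factor that may be negative.
    -- Arbitrary `δ` serves both sides of the inequality.
    have key : ∀ δ : ι → ℝ, (∀ i ∈ insert a s, δ i = 1 ∨ δ i = -1) →
        ∑ g, χ g * Real.exp (∑ i ∈ insert a s, J i * (δ i * ψ i g))
          = Real.cosh (J a) * ∑ g, χ g * Real.exp (∑ i ∈ s, J i * (δ i * ψ i g))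
          + δ a * Real.sinh (J a) *
            ∑ g, (χ * ψ a) g * Real.exp (∑ i ∈ s, J i * (δ i * ψ i g)) := by
      intro δ hδ
      rw [Finset.mul_sum, Finset.mul_sum, ← Finset.sum_add_distrib]
      refine Finset.sum_congr rfl fun g _ => ?_
      have h1 : δ a * ψ a g = 1 ∨ δ a * ψ a g = -1 := by
        rcases hδ a (Finset.mem_insert_self a s) with h | h <;>
          rcases char_eq_one_or_neg_one hG (ψ a) g with h' | h' <;> simp [h, h']
      rw [Finset.sum_insert ha, Real.exp_add, exp_mul_sign _ h1, MonoidHom.mul_apply]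
      ring
    have h2 := key (fun _ => 1) (fun i _ => Or.inl rfl)
    simp only [one_mul] at h2
    rw [key ε hε, h2]
    have hJ' : ∀ i ∈ s, 0 ≤ J i := fun i hi => hJ i (Finset.mem_insert_of_mem hi)
    have hε' : ∀ i ∈ s, ε i = 1 ∨ ε i = -1 := fun i hi => hε i (Finset.mem_insert_of_mem hi)
    have hs : 0 ≤ Real.sinh (J a) := Real.sinh_nonneg_iff.mpr (hJ a (Finset.mem_insert_self a s))
    have hc : 0 ≤ Real.cosh (J a) := (Real.cosh_pos _).le
    have e1 : |ε a| = 1 := by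
      rcases hε a (Finset.mem_insert_self a s) with h | h <;> simp [h]
    refine (abs_add_le _ _).trans (add_le_add ?_ ?_)
    · rw [abs_mul, abs_of_nonneg hc]
      exact mul_le_mul_of_nonneg_left (ih hJ' hε' χ) hc
    · rw [abs_mul, abs_mul, e1, abs_of_nonneg hs, one_mul]
      exact mul_le_mul_of_nonneg_left (ih hJ' hε' (χ * ψ a)) hs

/-- The first Griffiths inequality. -/
theorem sum_char_mul_exp_nonneg (hG : ∀ g : G, g * g = 1) {ι : Type*} (s : Finset ι)
    (J : ι → ℝ) (hJ : ∀ i ∈ s, 0 ≤ J i) (ψ : ι → G →* ℝ) (χ : G →* ℝ) :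
    0 ≤ ∑ g, χ g * Real.exp (∑ i ∈ s, J i * ψ i g) :=
  (abs_nonneg _).trans (abs_sum_char_mul_exp_le hG s J 1 hJ (fun _ _ => Or.inl rfl) ψ χ)

/-- The second Griffiths inequality. -/
theorem sum_char_mul_sum_char_le (hG : ∀ g : G, g * g = 1) {ι : Type*} (s : Finset ι)
    (J : ι → ℝ) (hJ : ∀ i ∈ s, 0 ≤ J i) (ψ : ι → G →* ℝ) (χ η : G →* ℝ) :
    (∑ g, χ g * Real.exp (∑ i ∈ s, J i * ψ i g)) * (∑ g, η g * Real.exp (∑ i ∈ s, J i * ψ i g))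
      ≤ (∑ g, χ g * η g * Real.exp (∑ i ∈ s, J i * ψ i g)) *
        ∑ g, Real.exp (∑ i ∈ s, J i * ψ i g) := by
  set E : G → ℝ := fun g => Real.exp (∑ i ∈ s, J i * ψ i g) with hE
  -- Two copies of the system, the second written as `g * t`. For fixed `t` they form one system
  -- with couplings `J i * (1 + ψ i t) ≥ 0`, and the difference of the two sides is `1 - η t` times
  -- a sum covered by the first inequality.
  have h1 : ∀ F H : G → ℝ, (∑ g, F g) * ∑ g, H g = ∑ t, ∑ g, F g * H (g * t) := by
    intro F H
    rw [Finset.sum_comm, Finset.sum_mul]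
    refine Finset.sum_congr rfl fun g _ => ?_
    rw [← Finset.mul_sum]
    exact congrArg (F g * ·) (Equiv.sum_comp (Equiv.mulLeft g) H).symm
  rw [h1, h1, ← sub_nonneg, ← Finset.sum_sub_distrib]
  refine Finset.sum_nonneg fun t _ => ?_
  have hnn : ∀ i ∈ s, 0 ≤ J i * (1 + ψ i t) := fun i hi => by
    rcases char_eq_one_or_neg_one hG (ψ i) t with h | h <;> rw [h]
    · linarith [hJ i hi]
    · simp
  have h2 := sum_char_mul_exp_nonneg hG s (fun i => J i * (1 + ψ i t)) hnn ψ (χ * η)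
  have h3 : 0 ≤ 1 - η t := by rcases char_eq_one_or_neg_one hG η t with h | h <;> norm_num [h]
  have h4 := mul_nonneg h3 h2
  rw [Finset.mul_sum] at h4
  rw [← Finset.sum_sub_distrib]
  refine h4.trans_eq (Finset.sum_congr rfl fun g _ => ?_)
  have h5 : E g * E (g * t) = Real.exp (∑ i ∈ s, J i * (1 + ψ i t) * ψ i g) := by
    simp only [hE, map_mul]
    rw [← Real.exp_add, ← Finset.sum_add_distrib]
    congr 1
    exact Finset.sum_congr rfl fun i _ => by ring
  rw [← h5, MonoidHom.mul_apply, map_mul]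
  ring

end Characters

/-! ### Spins and bonds as characters; the critical coupling. -/

theorem plusSpin_of_mem {Λ : Finset Site} (τ : Λ → ℤˣ) {x : Site} (h : x ∈ Λ) :
    plusSpin Λ τ x = ((τ ⟨x, h⟩ : ℤ) : ℝ) := by simp [plusSpin, h]

theorem plusSpin_of_notMem {Λ : Finset Site} (τ : Λ → ℤˣ) {x : Site} (h : x ∉ Λ) :
    plusSpin Λ τ x = 1 := by simp [plusSpin, h]

/-- The spin at a site, as a character of the group of spin configurations. -/
noncomputable def spinHom (Λ : Finset Site) (x : Site) : (Λ → ℤˣ) →* ℝ where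
  toFun τ := plusSpin Λ τ x
  map_one' := by by_cases h : x ∈ Λ <;> simp [plusSpin, h]
  map_mul' τ τ' := by by_cases h : x ∈ Λ <;> simp [plusSpin, h]

@[simp] theorem spinHom_apply (Λ : Finset Site) (x : Site) (τ : Λ → ℤˣ) :
    spinHom Λ x τ = plusSpin Λ τ x := rfl

theorem plusSpin_mul (Λ : Finset Site) (τ τ' : Λ → ℤˣ) (x : Site) :
    plusSpin Λ (τ * τ') x = plusSpin Λ τ x * plusSpin Λ τ' x := map_mul (spinHom Λ x) τ τ'

/-- The product of the spins at the ends of a bond, as a character. -/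
noncomputable def bondHom (Λ : Finset Site) (e : Sym2 Site) : (Λ → ℤˣ) →* ℝ where
  toFun τ := (e.map (plusSpin Λ τ)).mul
  map_one' := by
    induction e using Sym2.ind with
    | _ x y =>
      simpa using congrArg₂ (· * ·) (map_one (spinHom Λ x)) (map_one (spinHom Λ y))
  map_mul' τ τ' := by
    induction e using Sym2.ind with
    | _ x y =>
      simp only [Sym2.map_mk, Sym2.mul_mk, plusSpin_mul]
      ring

@[simp] theorem bondHom_apply (Λ : Finset Site) (e : Sym2 Site) (τ : Λ → ℤˣ) :
    bondHom Λ e τ = (e.map (plusSpin Λ τ)).mul := rfl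

theorem mul_self_config {Λ : Finset Site} (τ : Λ → ℤˣ) : τ * τ = 1 := by
  ext x; simp

theorem plusSpin_eq_one_or (Λ : Finset Site) (τ : Λ → ℤˣ) (x : Site) :
    plusSpin Λ τ x = 1 ∨ plusSpin Λ τ x = -1 :=
  char_eq_one_or_neg_one mul_self_config (spinHom Λ x) τ

/-- The unnormalized expectation in the critical model in which the coupling at the bond `e` is
multiplied by `ε e`. -/
noncomputable def twistedSum (Λ : Finset Site) (ε : Sym2 Site → ℝ) (f : (Site → ℝ) → ℝ) : ℝ :=
  ∑ τ : Λ → ℤˣ, f (plusSpin Λ τ) *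
    Real.exp (∑ e ∈ bonds Λ, coupling θcrit * (ε e * (e.map (plusSpin Λ τ)).mul))

theorem plusExp_eq_twistedSum (Λ : Finset Site) (f : (Site → ℝ) → ℝ) :
    plusExp θcrit Λ f = twistedSum Λ 1 f / twistedSum Λ 1 1 := by
  simp [plusExp, twistedSum, weight, Finset.mul_sum]

theorem twistedSum_one_pos (Λ : Finset Site) (ε : Sym2 Site → ℝ) : 0 < twistedSum Λ ε 1 := by
  simp only [twistedSum, Pi.one_apply, one_mul]
  exact Finset.sum_pos (fun _ _ => Real.exp_pos _) Finset.univ_nonempty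

theorem tan_critical : Real.tan (θcrit / 2) = √2 - 1 := by
  have h8 : θcrit / 2 = Real.pi / 8 := by rw [θcrit]; ring
  rw [h8, Real.tan_eq_sin_div_cos]
  have hc : 0 < Real.cos (Real.pi / 8) := by
    apply Real.cos_pos_of_mem_Ioo; constructor <;> linarith [Real.pi_pos]
  have h1 : Real.cos (Real.pi / 4) = 2 * Real.cos (Real.pi / 8) ^ 2 - 1 := by
    rw [← Real.cos_two_mul]; congr 1; ring
  have h2 : Real.sin (Real.pi / 4) = 2 * Real.sin (Real.pi / 8) * Real.cos (Real.pi / 8) := by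
    rw [← Real.sin_two_mul]; congr 1; ring
  rw [Real.cos_pi_div_four] at h1
  rw [Real.sin_pi_div_four] at h2
  have h3 : √2 ^ 2 = (2 : ℝ) := Real.sq_sqrt (by norm_num)
  rw [div_eq_iff hc.ne']
  have : Real.sin (Real.pi / 8) * (2 * Real.cos (Real.pi / 8))
      = (√2 - 1) * Real.cos (Real.pi / 8) * (2 * Real.cos (Real.pi / 8)) := by
    linear_combination -h2 + (√2 - 1) * h1 - h3 / 2
  exact mul_right_cancel₀ (by positivity) this

theorem exp_coupling : Real.exp (2 * coupling θcrit) = √2 + 1 := by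
  have h3 : √2 ^ 2 = (2 : ℝ) := Real.sq_sqrt (by norm_num)
  have h1 : (0 : ℝ) < √2 - 1 := by
    have : (1 : ℝ) < √2 := by rw [Real.lt_sqrt] <;> norm_num
    linarith
  have h2 : 2 * coupling θcrit = -Real.log (√2 - 1) := by rw [coupling, tan_critical]; ring
  rw [h2, Real.exp_neg, Real.exp_log h1]
  exact inv_eq_of_mul_eq_one_left (by linear_combination h3)

theorem coupling_nonneg : 0 ≤ coupling θcrit := by
  have h : Real.exp 0 ≤ Real.exp (2 * coupling θcrit) := by
    rw [exp_coupling, Real.exp_zero]; linarith [Real.sqrt_nonneg 2]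
  linarith [Real.exp_le_exp.mp h]

/-- Criticality enters the linear relations here: reversing a coupling multiplies the weight by `√2
- x`, with `x` the signed product of the spins of the bond. -/
theorem exp_coupling_sign {x : ℝ} (hx : x = 1 ∨ x = -1) :
    Real.exp (-(2 * coupling θcrit * x)) = √2 - x := by
  have h3 : √2 ^ 2 = (2 : ℝ) := Real.sq_sqrt (by norm_num)
  have h4 : (0 : ℝ) < √2 + 1 := by positivity
  rcases hx with rfl | rfl
  · rw [mul_one, Real.exp_neg, exp_coupling]
    exact inv_eq_of_mul_eq_one_left (by linear_combination h3)
  · rw [mul_neg_one, neg_neg, exp_coupling]; ring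

/-- An estimate of disorder-order correlations. -/
theorem abs_twistedSum_le (Λ : Finset Site) (ε : Sym2 Site → ℝ)
    (hε : ∀ e, ε e = 1 ∨ ε e = -1) (x y : Site) :
    |twistedSum Λ ε fun σ => σ x * σ y| ≤ twistedSum Λ 1 1 := by
  have h := abs_sum_char_mul_exp_le mul_self_config (bonds Λ) (fun _ => coupling θcrit) ε
    (fun _ _ => coupling_nonneg) (fun e _ => hε e) (bondHom Λ) (spinHom Λ x * spinHom Λ y)
  simp only [MonoidHom.mul_apply, spinHom_apply, bondHom_apply] at h
  refine h.trans ?_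
  simp only [twistedSum, Pi.one_apply, one_mul]
  refine Finset.sum_le_sum fun τ _ => mul_le_of_le_one_left (Real.exp_pos _).le ?_
  rcases plusSpin_eq_one_or Λ τ x with h | h <;> rcases plusSpin_eq_one_or Λ τ y with h' | h' <;>
    norm_num [h, h']

/-! ### Monotonicity in the domain and infinite-volume limits. -/

/-- Configurations in `Λ` as configurations in a larger domain. -/
noncomputable def extendConfig {Λ Λ' : Finset Site} (τ : Λ → ℤˣ) : Λ' → ℤˣ := by
  classical exact fun x => if h : x.1 ∈ Λ then τ ⟨x.1, h⟩ else 1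

theorem plusSpin_extendConfig {Λ Λ' : Finset Site} (h : Λ ⊆ Λ') (τ : Λ → ℤˣ) :
    plusSpin Λ' (extendConfig τ) = plusSpin Λ τ := by
  ext x
  by_cases h1 : x ∈ Λ
  · rw [plusSpin_of_mem _ (h h1), plusSpin_of_mem _ h1]; simp [extendConfig, h1]
  · rw [plusSpin_of_notMem _ h1]
    by_cases h2 : x ∈ Λ'
    · rw [plusSpin_of_mem _ h2]; simp [extendConfig, h1]
    · rw [plusSpin_of_notMem _ h2]

theorem extendConfig_injective {Λ Λ' : Finset Site} (h : Λ ⊆ Λ') :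
    Function.Injective (extendConfig : (Λ → ℤˣ) → (Λ' → ℤˣ)) := by
  intro τ τ' hτ
  ext x
  have := congrFun hτ ⟨x.1, h x.2⟩
  simp only [extendConfig, Finset.coe_mem, dite_true] at this
  rw [this]

theorem bonds_mono {Λ Λ' : Finset Site} (h : Λ ⊆ Λ') : bonds Λ ⊆ bonds Λ' := by
  intro e he
  rw [mem_bonds] at he ⊢
  exact ⟨he.1, he.2.imp fun x hx => ⟨h hx.1, hx.2⟩⟩

/-- The model in the smaller domain is the model in the larger one, conditioned on the spins outside
the smaller domain. -/
theorem sum_prod_mul_eq {Λ Λ' : Finset Site} (h : Λ ⊆ Λ') :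
    ∃ c : ℝ, 0 < c ∧ ∀ f : (Site → ℝ) → ℝ,
      twistedSum Λ' 1 (fun σ => f σ * ∏ z ∈ Λ' \ Λ, (1 + σ z)) = c * twistedSum Λ 1 f := by
  refine ⟨2 ^ (Λ' \ Λ).card *
    Real.exp (∑ e ∈ bonds Λ' \ bonds Λ, coupling θcrit), by positivity, fun f => ?_⟩
  simp only [twistedSum]
  -- The product vanishes unless all spins of `Λ' \ Λ` are `+1`, so only extended configurations
  -- contribute; the additional bonds then give a constant factor.
  have himg : ∑ τ : Λ' → ℤˣ, (f (plusSpin Λ' τ) * ∏ z ∈ Λ' \ Λ, (1 + plusSpin Λ' τ z)) *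
      Real.exp (∑ e ∈ bonds Λ', coupling θcrit * ((1 : Sym2 Site → ℝ) e *
        (e.map (plusSpin Λ' τ)).mul))
      = ∑ τ ∈ Finset.univ.image (extendConfig : (Λ → ℤˣ) → (Λ' → ℤˣ)),
        (f (plusSpin Λ' τ) * ∏ z ∈ Λ' \ Λ, (1 + plusSpin Λ' τ z)) *
      Real.exp (∑ e ∈ bonds Λ', coupling θcrit * ((1 : Sym2 Site → ℝ) e *
        (e.map (plusSpin Λ' τ)).mul)) := by
    symm
    refine Finset.sum_subset (Finset.subset_univ _) fun τ _ hτ => ?_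
    have : ∃ z ∈ Λ' \ Λ, 1 + plusSpin Λ' τ z = 0 := by
      by_contra! hcon
      apply hτ
      rw [Finset.mem_image]
      refine ⟨fun x => τ ⟨x.1, h x.2⟩, Finset.mem_univ _, ?_⟩
      funext x
      by_cases hx : x.1 ∈ Λ
      · simp [extendConfig, hx]
      · have h1 := hcon x.1 (Finset.mem_sdiff.mpr ⟨x.2, hx⟩)
        rw [plusSpin_of_mem _ x.2] at h1
        rcases Int.units_eq_one_or (τ x) with h2 | h2
        · simp [extendConfig, hx, h2]
        · simp [h2] at h1
    obtain ⟨z, hz, h0⟩ := this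
    rw [Finset.prod_eq_zero hz h0]
    simp
  rw [himg, Finset.sum_image (fun _ _ _ _ h' => extendConfig_injective h h'), Finset.mul_sum]
  refine Finset.sum_congr rfl fun τ _ => ?_
  simp only [plusSpin_extendConfig h]
  have h1 : ∏ z ∈ Λ' \ Λ, (1 + plusSpin Λ τ z) = 2 ^ (Λ' \ Λ).card := by
    rw [Finset.prod_congr rfl (g := fun _ => (2 : ℝ))]
    · simp
    · intro z hz
      rw [plusSpin_of_notMem _ (Finset.mem_sdiff.mp hz).2]; norm_num
  have h2 : ∑ e ∈ bonds Λ' \ bonds Λ, coupling θcrit * ((1 : Sym2 Site → ℝ) e *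
      (e.map (plusSpin Λ τ)).mul) = ∑ e ∈ bonds Λ' \ bonds Λ, coupling θcrit := by
    refine Finset.sum_congr rfl fun e he => ?_
    rw [Finset.mem_sdiff, mem_bonds, mem_bonds] at he
    induction e using Sym2.ind with
    | _ x y =>
      have hx : x ∉ Λ := fun hx => he.2 ⟨he.1.1, x, hx, by simp⟩
      have hy : y ∉ Λ := fun hy => he.2 ⟨he.1.1, y, hy, by simp⟩
      simp [plusSpin_of_notMem, hx, hy]
  rw [h1, ← Finset.sum_sdiff (bonds_mono h), h2, Real.exp_add]
  ring

/-- Shrinking the domain conditions on spins being `+1`. Expanding `∏ (1 + σ z)` over subsets `A`,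
each term is an instance of the second Griffiths inequality for `σ x * σ y` and `∏ z ∈ A, σ z`. -/
theorem plusExp_antitone {Λ Λ' : Finset Site} (h : Λ ⊆ Λ') (x y : Site) :
    plusExp θcrit Λ' (fun σ => σ x * σ y) ≤ plusExp θcrit Λ (fun σ => σ x * σ y) := by
  obtain ⟨c, hc, hΛ⟩ := sum_prod_mul_eq h
  rw [plusExp_eq_twistedSum, plusExp_eq_twistedSum,
    ← mul_div_mul_left (twistedSum Λ 1 _) (twistedSum Λ 1 1) hc.ne', ← hΛ, ← hΛ,
    div_le_div_iff₀ (twistedSum_one_pos _ _) (by rw [hΛ]; exact mul_pos hc (twistedSum_one_pos _ _))]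
  have key : ∀ f : (Site → ℝ) → ℝ, twistedSum Λ' 1 (fun σ => f σ * ∏ z ∈ Λ' \ Λ, (1 + σ z))
      = ∑ A ∈ (Λ' \ Λ).powerset, twistedSum Λ' 1 (fun σ => f σ * ∏ z ∈ A, σ z) := by
    intro f
    simp only [twistedSum]
    rw [Finset.sum_comm]
    refine Finset.sum_congr rfl fun τ _ => ?_
    rw [Finset.prod_one_add, Finset.mul_sum, Finset.sum_mul]
  rw [key, key, Finset.mul_sum, Finset.sum_mul]
  refine Finset.sum_le_sum fun A _ => ?_
  have hp : ∀ τ : Λ' → ℤˣ, (∏ z ∈ A, spinHom Λ' z) τ = ∏ z ∈ A, plusSpin Λ' τ z := by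
    intro τ; rw [MonoidHom.finsetProd_apply]; rfl
  have h2 := sum_char_mul_sum_char_le mul_self_config (bonds Λ') (fun _ => coupling θcrit)
    (fun _ _ => coupling_nonneg) (bondHom Λ') (spinHom Λ' x * spinHom Λ' y) (∏ z ∈ A, spinHom Λ' z)
  simp only [MonoidHom.mul_apply, hp, spinHom_apply, bondHom_apply] at h2
  simpa [twistedSum] using h2

theorem plusExp_nonneg (Λ : Finset Site) (x y : Site) :
    0 ≤ plusExp θcrit Λ (fun σ => σ x * σ y) := by
  rw [plusExp_eq_twistedSum]
  refine div_nonneg ?_ (twistedSum_one_pos _ _).le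
  have h := sum_char_mul_exp_nonneg mul_self_config (bonds Λ) (fun _ => coupling θcrit)
    (fun _ _ => coupling_nonneg) (bondHom Λ) (spinHom Λ x * spinHom Λ y)
  simpa [twistedSum] using h

theorem tendsto_diagCorrIn (n : ℕ) : Tendsto (diagCorrIn n) atTop (𝓝 (D n)) := by
  refine tendsto_nhds_limUnder ⟨_, tendsto_atTop_ciInf (fun Λ Λ' h => ?_) ⟨0, ?_⟩⟩
  · exact plusExp_antitone h _ _
  · rintro _ ⟨Λ, rfl⟩
    exact plusExp_nonneg _ _ _

/-- The origin lies outside every half-plane domain and has spin `+1`, so the magnetization is a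
two-point function. -/
theorem magIn_eq (m : ℕ) (Λ : Finset InnerSite) :
    magIn m Λ = plusExp θcrit (Λ.map (Function.Embedding.subtype _))
      fun σ => σ (axisSite (-m)) * σ (axisSite 0) := by
  rw [magIn, plusExp, plusExp]
  congr 1
  refine Finset.sum_congr rfl fun τ _ => ?_
  rw [plusSpin_of_notMem (x := axisSite 0), mul_one]
  simp [axisSite]

theorem tendsto_magIn (m : ℕ) : Tendsto (magIn m) atTop (𝓝 (M m)) := by
  refine tendsto_nhds_limUnder ⟨_, tendsto_atTop_ciInf (fun Λ Λ' h => ?_) ⟨0, ?_⟩⟩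
  · rw [magIn_eq, magIn_eq]
    exact plusExp_antitone (Finset.map_subset_map.mpr h) _ _
  · rintro _ ⟨Λ, rfl⟩
    rw [magIn_eq]
    exact plusExp_nonneg _ _ _

/-! ### Disorder lines: moves across a bond, gauge changes, lattice symmetries. -/

theorem mk_mem_bonds {Λ : Finset Site} {x y : Site} :
    s(x, y) ∈ bonds Λ ↔ grid.Adj x y ∧ (x ∈ Λ ∨ y ∈ Λ) := by
  rw [mem_bonds, SimpleGraph.mem_edgeSet]
  refine and_congr_right fun _ => ⟨?_, ?_⟩
  · rintro ⟨z, hz, h⟩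
    rcases Sym2.mem_iff.mp h with rfl | rfl
    exacts [Or.inl hz, Or.inr hz]
  · rintro (h | h)
    exacts [⟨x, h, by simp⟩, ⟨y, h, by simp⟩]

theorem bondHom_mul_self (Λ : Finset Site) (e : Sym2 Site) (t : Λ → ℤˣ) :
    (e.map (plusSpin Λ t)).mul * (e.map (plusSpin Λ t)).mul = 1 := by
  have h := map_mul (bondHom Λ e) t t
  rw [mul_self_config, map_one] at h
  exact h.symm

/-- Moving one end of a disorder line across a bond, combined with a change of gauge. -/
theorem twistedSum_move {Λ : Finset Site} {ε ε' : Sym2 Site → ℝ} (t : Λ → ℤˣ) {x y : Site}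
    (z : Site) (hxy : s(x, y) ∈ bonds Λ) (hε : ε s(x, y) = 1 ∨ ε s(x, y) = -1)
    (h0 : ε' s(x, y) = -ε s(x, y) * (plusSpin Λ t x * plusSpin Λ t y))
    (h : ∀ e ∈ bonds Λ, e ≠ s(x, y) → ε' e = ε e * (e.map (plusSpin Λ t)).mul) :
    twistedSum Λ ε' (fun σ => σ x * σ z) = plusSpin Λ t x * plusSpin Λ t z *
      (√2 * twistedSum Λ ε (fun σ => σ x * σ z)
        - ε s(x, y) * twistedSum Λ ε (fun σ => σ y * σ z)) := by
  simp only [twistedSum]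
  rw [← Equiv.sum_comp (Equiv.mulRight t), Finset.mul_sum, Finset.mul_sum,
    ← Finset.sum_sub_distrib, Finset.mul_sum]
  refine Finset.sum_congr rfl fun τ _ => ?_
  have h1 : ∀ e : Sym2 Site, (e.map (plusSpin Λ (τ * t))).mul
      = (e.map (plusSpin Λ τ)).mul * (e.map (plusSpin Λ t)).mul :=
    fun e => map_mul (bondHom Λ e) τ t
  have hs : ε s(x, y) * (plusSpin Λ τ x * plusSpin Λ τ y) = 1 ∨
      ε s(x, y) * (plusSpin Λ τ x * plusSpin Λ τ y) = -1 := by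
    rcases hε with h | h <;> rcases plusSpin_eq_one_or Λ τ x with h' | h' <;>
    rcases plusSpin_eq_one_or Λ τ y with h'' | h'' <;> simp [h, h', h'']
  have hx : plusSpin Λ τ x * plusSpin Λ τ x = 1 := by
    rcases plusSpin_eq_one_or Λ τ x with h' | h' <;> simp [h']
  -- After `τ ↦ τ * t` the gauge signs cancel at every bond except `s(x, y)`, whose coupling is
  -- reversed. The resulting factor `√2 - ε σ_x σ_y`, multiplied by `σ_x`, is linear in the spins
  -- since `σ_x ^ 2 = 1`.
  have h2 : ∑ e ∈ bonds Λ, coupling θcrit * (ε' e * (e.map (plusSpin Λ (τ * t))).mul)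
      = ∑ e ∈ bonds Λ, coupling θcrit * (ε e * (e.map (plusSpin Λ τ)).mul)
        + -(2 * coupling θcrit * (ε s(x, y) * (plusSpin Λ τ x * plusSpin Λ τ y))) := by
    rw [← Finset.add_sum_erase _ _ hxy,
      ← Finset.add_sum_erase _ (fun e => coupling θcrit * (ε e * (e.map (plusSpin Λ τ)).mul)) hxy]
    have h3 : ∑ e ∈ (bonds Λ).erase s(x, y), coupling θcrit *
        (ε' e * (e.map (plusSpin Λ (τ * t))).mul)
        = ∑ e ∈ (bonds Λ).erase s(x, y), coupling θcrit * (ε e * (e.map (plusSpin Λ τ)).mul) := by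
      refine Finset.sum_congr rfl fun e he => ?_
      rw [Finset.mem_erase] at he
      rw [h e he.2 he.1, h1]
      linear_combination (coupling θcrit * ε e * (e.map (plusSpin Λ τ)).mul) *
        bondHom_mul_self Λ e t
    rw [h3, h1, h0]
    have h4 := bondHom_mul_self Λ s(x, y) t
    simp only [Sym2.map_mk, Sym2.mul_mk] at h4 ⊢
    linear_combination (-coupling θcrit * ε s(x, y) * (plusSpin Λ τ x * plusSpin Λ τ y)) * h4
  rw [Equiv.coe_mulRight, h2, Real.exp_add, exp_coupling_sign hs, plusSpin_mul, plusSpin_mul]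
  set Ex := Real.exp (∑ e ∈ bonds Λ, coupling θcrit * (ε e * (e.map (plusSpin Λ τ)).mul))
  linear_combination (-plusSpin Λ t x * plusSpin Λ t z * ε s(x, y) * Ex * plusSpin Λ τ y *
    plusSpin Λ τ z) * hx

theorem twistedSum_gauge {Λ : Finset Site} {ε ε' : Sym2 Site → ℝ} (t : Λ → ℤˣ) (x z : Site)
    (h : ∀ e ∈ bonds Λ, ε' e = ε e * (e.map (plusSpin Λ t)).mul) :
    twistedSum Λ ε' (fun σ => σ x * σ z) = plusSpin Λ t x * plusSpin Λ t z *
      twistedSum Λ ε (fun σ => σ x * σ z) := by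
  simp only [twistedSum]
  rw [← Equiv.sum_comp (Equiv.mulRight t), Finset.mul_sum]
  refine Finset.sum_congr rfl fun τ _ => ?_
  have h2 : ∑ e ∈ bonds Λ, coupling θcrit * (ε' e * (e.map (plusSpin Λ (τ * t))).mul)
      = ∑ e ∈ bonds Λ, coupling θcrit * (ε e * (e.map (plusSpin Λ τ)).mul) := by
    refine Finset.sum_congr rfl fun e he => ?_
    have h1 : (e.map (plusSpin Λ (τ * t))).mul
      = (e.map (plusSpin Λ τ)).mul * (e.map (plusSpin Λ t)).mul := map_mul (bondHom Λ e) τ t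
    rw [h e he, h1]
    linear_combination (coupling θcrit * ε e * (e.map (plusSpin Λ τ)).mul) *
      bondHom_mul_self Λ e t
  rw [Equiv.coe_mulRight, h2, plusSpin_mul, plusSpin_mul]
  ring

theorem mem_map_bonds {Λ Λ' : Finset Site} {φ : Site ≃ Site} (hΛ : ∀ x ∈ Λ, φ x ∈ Λ')
    (hφ : ∀ x y, grid.Adj x y → grid.Adj (φ x) (φ y)) {e : Sym2 Site}
    (he : e ∈ bonds Λ) : e.map φ ∈ bonds Λ' := by
  induction e using Sym2.ind with
  | _ x y =>
    rw [mk_mem_bonds] at he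
    rw [Sym2.map_mk, mk_mem_bonds]
    exact ⟨hφ x y he.1, he.2.imp (hΛ x) (hΛ y)⟩

theorem map_symm_map (φ : Site ≃ Site) (e : Sym2 Site) : (e.map φ).map φ.symm = e := by
  induction e using Sym2.ind with
  | _ x y => simp

/-- Invariance of the model under the automorphisms of the grid. -/
theorem twistedSum_map {Λ Λ' : Finset Site} (φ : Site ≃ Site) (hΛ : ∀ x, φ x ∈ Λ' ↔ x ∈ Λ)
    (hφ : ∀ x y, grid.Adj x y → grid.Adj (φ x) (φ y))
    (hφ' : ∀ x y, grid.Adj x y → grid.Adj (φ.symm x) (φ.symm y)) (ε : Sym2 Site → ℝ)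
    (f : (Site → ℝ) → ℝ) :
    twistedSum Λ (fun e => ε (e.map φ)) (fun σ => f (σ ∘ φ.symm)) = twistedSum Λ' ε f := by
  have hΛ' : ∀ x ∈ Λ', φ.symm x ∈ Λ := fun x hx => by rw [← hΛ]; simpa using hx
  let R : Λ ≃ Λ' := ⟨fun x => ⟨φ x.1, (hΛ x.1).mpr x.2⟩, fun x => ⟨φ.symm x.1, hΛ' x.1 x.2⟩,
    fun x => Subtype.ext (φ.symm_apply_apply _), fun x => Subtype.ext (φ.apply_symm_apply _)⟩
  have hR : ∀ τ : Λ' → ℤˣ, plusSpin Λ (τ ∘ R) = plusSpin Λ' τ ∘ φ := by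
    intro τ
    funext u
    by_cases hu : u ∈ Λ
    · rw [Function.comp_apply, plusSpin_of_mem _ hu, plusSpin_of_mem _ ((hΛ u).mpr hu)]
      rfl
    · rw [plusSpin_of_notMem _ hu, Function.comp_apply, plusSpin_of_notMem]
      rwa [hΛ]
  simp only [twistedSum]
  rw [← Equiv.sum_comp (Equiv.arrowCongr R (Equiv.refl ℤˣ)).symm]
  refine Finset.sum_congr rfl fun τ _ => ?_
  have e1 : (Equiv.arrowCongr R (Equiv.refl ℤˣ)).symm τ = τ ∘ R := rfl
  have e2 : plusSpin Λ' τ ∘ φ ∘ φ.symm = plusSpin Λ' τ := by funext u; simp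
  rw [e1, hR, Function.comp_assoc, e2]
  congr 2
  refine Finset.sum_nbij' (Sym2.map φ) (Sym2.map φ.symm)
    (fun e he => mem_map_bonds (fun x hx => (hΛ x).mpr hx) hφ he)
    (fun e he => mem_map_bonds hΛ' hφ' he)
    (fun e _ => map_symm_map φ e) (fun e _ => map_symm_map φ.symm e) fun e _ => ?_
  rw [Sym2.map_map]

/-- The reflection in the horizontal axis. -/
def reflect : Site ≃ Site where
  toFun x := ⟨(x.1.1, -x.1.2), by have := x.2; rw [Int.even_add] at *; simpa⟩
  invFun x := ⟨(x.1.1, -x.1.2), by have := x.2; rw [Int.even_add] at *; simpa⟩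
  left_inv x := by ext <;> simp
  right_inv x := by ext <;> simp

@[simp] theorem reflect_val (x : Site) : (reflect x).1 = (x.1.1, -x.1.2) := rfl

theorem reflect_symm : reflect.symm = reflect := rfl

theorem reflect_adj (x y : Site) (h : grid.Adj x y) : grid.Adj (reflect x) (reflect y) := by
  refine ⟨h.1, ?_⟩
  have := h.2
  rw [abs_sub_comm] at this
  simp only [reflect_val]
  rwa [neg_sub_neg]

/-- The translation by `2j` along the horizontal axis. -/
def translate (j : ℤ) : Site ≃ Site where
  toFun x := ⟨(x.1.1 + 2 * j, x.1.2), by have := x.2; rw [Int.even_add, Int.even_add] at *; simpa⟩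
  invFun x := ⟨(x.1.1 - 2 * j, x.1.2), by have := x.2; rw [Int.even_add, Int.even_sub] at *; simpa⟩
  left_inv x := by ext <;> simp
  right_inv x := by ext <;> simp

theorem translate_adj (j : ℤ) (x y : Site) (h : grid.Adj x y) :
    grid.Adj (translate j x) (translate j y) := by
  refine ⟨?_, h.2⟩
  have := h.1
  simpa [translate] using this

theorem translate_symm_adj (j : ℤ) (x y : Site) (h : grid.Adj x y) :
    grid.Adj ((translate j).symm x) ((translate j).symm y) := by
  refine ⟨?_, h.2⟩
  have := h.1
  simpa [translate] using this

theorem translate_symm_axisSite (j i : ℤ) : (translate j).symm (axisSite i) = axisSite (i - j) := by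
  apply Subtype.ext
  simp [translate, axisSite]
  ring

/-! ### Disorder lines in a box, and how they change under moves and reflection. -/

/-- The sum of the coordinates `a + s` of the ends of a bond. -/
def sumA : Sym2 Site → ℤ :=
  Sym2.lift ⟨fun x y => x.1.1 + x.1.2 + (y.1.1 + y.1.2), fun _ _ => add_comm _ _⟩

/-- The sum of the coordinates `a - s` of the ends of a bond. -/
def sumB : Sym2 Site → ℤ :=
  Sym2.lift ⟨fun x y => x.1.1 - x.1.2 + (y.1.1 - y.1.2), fun _ _ => add_comm _ _⟩

@[simp] theorem sumA_mk (x y : Site) : sumA s(x, y) = x.1.1 + x.1.2 + (y.1.1 + y.1.2) := rfl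
@[simp] theorem sumB_mk (x y : Site) : sumB s(x, y) = x.1.1 - x.1.2 + (y.1.1 - y.1.2) := rfl

/-- The disorder line of the face `(a, s)`: it runs diagonally downwards to the left, to the side of
the box of size `L`, and then along this side. The function is `-1` at the bonds it crosses. -/
def ray (L a s : ℤ) (e : Sym2 Site) : ℝ :=
  -- The value `-4 * L - 2` marks the bonds leaving the box through its lower left side. Because of
  -- the tail there, all lines end at the same place, so that sliding a line is exactly a gauge
  -- change.
  if (sumB e = 2 * (a - s) ∧ sumA e < 2 * (a + s)) ∨ (sumA e = -4 * L - 2 ∧ 2 * (a - s) < sumB e)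
    then -1 else 1

theorem ray_eq_one_or (L a s : ℤ) (e : Sym2 Site) : ray L a s e = 1 ∨ ray L a s e = -1 := by
  unfold ray; split_ifs <;> simp

theorem ray_mul_self (L a s : ℤ) (e : Sym2 Site) : ray L a s e * ray L a s e = 1 := by
  rcases ray_eq_one_or L a s e with h | h <;> simp [h]

theorem finite_dom (L w : ℤ) : {x : Site | (-2 * L ≤ x.1.1 + x.1.2 ∧ x.1.1 + x.1.2 ≤ 2 * L) ∧
    (-2 * L ≤ x.1.1 - x.1.2 ∧ x.1.1 - x.1.2 ≤ 2 * L) ∧ x.1.1 < w}.Finite := by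
  refine Set.Finite.subset
    (((Set.finite_Icc (-2 * L) (2 * L)).prod
      (Set.finite_Icc (-2 * L) (2 * L))).preimage
        (Subtype.val_injective.injOn : Set.InjOn (Subtype.val : Site → ℤ × ℤ) _)) ?_
  rintro x ⟨h1, h2, -⟩
  simp only [Set.mem_preimage, Set.mem_prod, Set.mem_Icc]
  omega

/-- The part of a box in the half-plane to the left of the column `a = w`. -/
noncomputable def dom (L w : ℤ) : Finset Site := (finite_dom L w).toFinset

theorem mem_dom {L w : ℤ} {x : Site} : x ∈ dom L w ↔
    (-2 * L ≤ x.1.1 + x.1.2 ∧ x.1.1 + x.1.2 ≤ 2 * L) ∧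
    (-2 * L ≤ x.1.1 - x.1.2 ∧ x.1.1 - x.1.2 ≤ 2 * L) ∧ x.1.1 < w := by
  simp [dom]

theorem reflect_mem_dom {L w : ℤ} {x : Site} (hx : x ∈ dom L w) : reflect x ∈ dom L w := by
  rw [mem_dom] at *
  simp only [reflect_val]
  omega

/-- The configuration with spins `-1` exactly on the set `S`. -/
noncomputable def flipConfig (Λ : Finset Site) (S : Site → Prop) : Λ → ℤˣ := by
  classical exact fun x => if S x then -1 else 1

theorem plusSpin_flipConfig (Λ : Finset Site) (S : Site → Prop) (x : Site)
    [Decidable (x ∈ Λ ∧ S x)] :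
    plusSpin Λ (flipConfig Λ S) x = if x ∈ Λ ∧ S x then -1 else 1 := by
  by_cases h : x ∈ Λ <;> by_cases h' : S x <;> simp [plusSpin, flipConfig, h, h']

/-- The site `(a, s)`. -/
def site (a s : ℤ) : Site := if h : Even (a + s) then ⟨(a, s), h⟩ else ⟨(0, 0), by simp⟩

theorem site_val {a s : ℤ} (h : Even (a + s)) : (site a s).1 = (a, s) := by simp [site, h]

theorem site_fst {a s : ℤ} (h : Even (a + s)) : (site a s).1.1 = a := by simp [site, h]
theorem site_snd {a s : ℤ} (h : Even (a + s)) : (site a s).1.2 = s := by simp [site, h]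

theorem site_axis (j : ℤ) : site (2 * j) 0 = axisSite j := by
  apply Subtype.ext; rw [site_val (by simp)]; rfl

theorem adj_cases {x y : Site} (h : grid.Adj x y) :
    (y.1.1 = x.1.1 + 1 ∨ y.1.1 = x.1.1 - 1) ∧ (y.1.2 = x.1.2 + 1 ∨ y.1.2 = x.1.2 - 1) := by
  have h1 := h.1
  have h2 := h.2
  rw [abs_eq (by norm_num)] at h1 h2
  omega

theorem site_adj {a s b t : ℤ} (h : Even (a + s)) (h' : Even (b + t)) (h1 : |a - b| = 1)
    (h2 : |s - t| = 1) : grid.Adj (site a s) (site b t) := by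
  refine ⟨?_, ?_⟩ <;> simpa [site_fst, site_snd, h, h']

theorem eq_mk_of_sums {x y x' y' : Site} (h : grid.Adj x y) (h' : grid.Adj x' y')
    (hA : sumA s(x, y) = sumA s(x', y')) (hB : sumB s(x, y) = sumB s(x', y')) :
    s(x, y) = s(x', y') := by
  have h1 := adj_cases h
  have h2 := adj_cases h'
  obtain ⟨k, hk⟩ := x.2
  obtain ⟨l, hl⟩ := y.2
  obtain ⟨k', hk'⟩ := x'.2
  obtain ⟨l', hl'⟩ := y'.2
  simp only [sumA_mk, sumB_mk] at hA hB
  rw [Sym2.eq_iff]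
  simp only [Subtype.ext_iff, Prod.ext_iff]
  omega

theorem ite_neg_one_eq {P Q R : Prop} [Decidable P] [Decidable Q] [Decidable R]
    (h : ¬(P ↔ (Q ↔ R))) : (if P then (-1 : ℝ) else 1) =
      if Q then -(if R then -1 else 1) else if R then -1 else 1 := by
  by_cases hP : P <;> by_cases hQ : Q <;> by_cases hR : R <;> simp_all

/-- One hypothesis per truth assignment of `S`, `P`, `Q`, `R`, each fixing `T` by parity, so that
every case becomes linear arithmetic. -/
theorem ite_neg_one_eq_mul {P Q R S T : Prop} [Decidable P] [Decidable Q] [Decidable R]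
    [Decidable S] [Decidable T]
    (h1 : S → P → Q → R → ¬T) (h2 : S → P → Q → ¬R → T) (h3 : S → P → ¬Q → R → T)
    (h4 : S → P → ¬Q → ¬R → ¬T) (h5 : S → ¬P → Q → R → T) (h6 : S → ¬P → Q → ¬R → ¬T)
    (h7 : S → ¬P → ¬Q → R → ¬T) (h8 : S → ¬P → ¬Q → ¬R → T) (h9 : ¬S → P → Q → R → T)
    (h10 : ¬S → P → Q → ¬R → ¬T) (h11 : ¬S → P → ¬Q → R → ¬T) (h12 : ¬S → P → ¬Q → ¬R → T)
    (h13 : ¬S → ¬P → Q → R → ¬T) (h14 : ¬S → ¬P → Q → ¬R → T) (h15 : ¬S → ¬P → ¬Q → R → T)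
    (h16 : ¬S → ¬P → ¬Q → ¬R → ¬T) :
    (if P then (-1 : ℝ) else 1) = (if R then -1 else 1) *
      ((if S then -1 else 1) * (if T then -1 else 1)) * if Q then -1 else 1 := by
  by_cases hQ : Q <;> by_cases hR : R <;> by_cases hS : S <;> by_cases hT : T <;> simp_all

/-- The disorder lines of `(a, s)` and of its neighbour to the upper right differ by one bond. -/
theorem ray_upRight {L a s : ℤ} (hp : Odd (a + s)) {x y : Site} (h : grid.Adj x y)
    (hL : -2 * L < a + s) :
    ray L (a + 1) (s + 1) s(x, y) = 
      if s(x, y) = s(site a (s + 1), site (a + 1) s) then -ray L a s s(x, y)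
      else ray L a s s(x, y) := by
  have hN : Even (a + (s + 1)) := by obtain ⟨k, hk⟩ := hp; exact ⟨k + 1, by omega⟩
  have hE : Even (a + 1 + s) := by obtain ⟨k, hk⟩ := hp; exact ⟨k + 1, by omega⟩
  have hadj : grid.Adj (site a (s + 1)) (site (a + 1) s) :=
    site_adj hN hE (by simp) (by simp)
  have key : s(x, y) = s(site a (s + 1), site (a + 1) s) ↔
      sumA s(x, y) = 2 * (a + s) + 2 ∧ sumB s(x, y) = 2 * (a - s) := by
    constructor
    · intro h
      rw [h]
      simp only [sumA_mk, sumB_mk, site_fst hN, site_fst hE, site_snd hN, site_snd hE]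
      omega
    · rintro ⟨h1, h2⟩
      refine eq_mk_of_sums h hadj ?_ ?_
      · rw [h1]; simp only [sumA_mk, site_fst hN, site_fst hE, site_snd hN, site_snd hE]; ring
      · rw [h2]; simp only [sumB_mk, site_fst hN, site_fst hE, site_snd hN, site_snd hE]; ring
  have hc := adj_cases h
  obtain ⟨p, hp⟩ := hp
  obtain ⟨k, hk⟩ := x.2
  obtain ⟨l, hl⟩ := y.2
  simp only [key]
  simp only [ray, sumA_mk, sumB_mk] at *
  clear key
  exact ite_neg_one_eq (by omega)

set_option maxHeartbeats 2000000 in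
/-- The disorder lines of `(a, s)` and of its neighbour to the upper left differ by one bond, up to
a change of gauge. -/
theorem ray_upLeft {L w a s : ℤ} (hp : Odd (a + s)) {x y : Site} (h : s(x, y) ∈ bonds (dom L w))
    (hL : -2 * L < a + s) (hL' : a + s ≤ 2 * L) (hB : -2 * L < a - s) (hB' : a - s ≤ 2 * L)
    (hw : a ≤ w) (t : dom L w → ℤˣ)
    (ht : t = flipConfig (dom L w) fun u => u.1.1 - u.1.2 = a - s - 1 ∧ u.1.1 + u.1.2 < a + s) :
    ray L (a - 1) (s + 1) s(x, y) = 
      ray L a s s(x, y) * (plusSpin (dom L w) t x * plusSpin (dom L w) t y) *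
        if s(x, y) = s(site (a - 1) s, site a (s + 1)) then -1 else 1 := by
  classical
  rw [mk_mem_bonds] at h
  obtain ⟨h, hm⟩ := h
  have hN : Even (a + (s + 1)) := by obtain ⟨k, hk⟩ := hp; exact ⟨k + 1, by omega⟩
  have hW : Even (a - 1 + s) := by obtain ⟨k, hk⟩ := hp; exact ⟨k, by omega⟩
  have hadj : grid.Adj (site (a - 1) s) (site a (s + 1)) :=
    site_adj hW hN (by simp) (by simp)
  have key : s(x, y) = s(site (a - 1) s, site a (s + 1)) ↔
      sumA s(x, y) = 2 * (a + s) ∧ sumB s(x, y) = 2 * (a - s) - 2 := by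
    constructor
    · intro h
      rw [h]
      simp only [sumA_mk, sumB_mk, site_fst hN, site_fst hW, site_snd hN, site_snd hW]
      omega
    · rintro ⟨h1, h2⟩
      refine eq_mk_of_sums h hadj ?_ ?_
      · rw [h1]; simp only [sumA_mk, site_fst hN, site_fst hW, site_snd hN, site_snd hW]; ring
      · rw [h2]; simp only [sumB_mk, site_fst hN, site_fst hW, site_snd hN, site_snd hW]; ring
  have hc := adj_cases h
  -- The two lines are parallel and the flipped sites form the diagonal between them; the tail of
  -- the line absorbs the bond from this diagonal out of the box.
  rw [ht, plusSpin_flipConfig, plusSpin_flipConfig]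
  simp only [mem_dom] at *
  obtain ⟨p, hp⟩ := hp
  obtain ⟨k, hk⟩ := x.2
  obtain ⟨l, hl⟩ := y.2
  simp only [key]
  simp only [ray, sumA_mk, sumB_mk] at *
  clear key ht hadj h
  apply ite_neg_one_eq_mul <;>
    (generalize x.1.1 = b at *
     generalize x.1.2 = c at *
     generalize y.1.1 = b' at *
     generalize y.1.2 = c' at *
     rcases hc with ⟨rfl | rfl, rfl | rfl⟩ <;> intros <;> omega)

set_option maxHeartbeats 2000000 in
/-- The disorder line of a face on the axis, together with its reflection, is a pure gauge up to a
part that does not depend on the face. -/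
theorem ray_reflect {L w a : ℤ} (hp : Odd a) {x y : Site} (h : s(x, y) ∈ bonds (dom L w))
    (hL : -2 * L < a) (hL' : a ≤ 2 * L) (hw : a ≤ w) (t : dom L w → ℤˣ)
    (ht : t = flipConfig (dom L w) fun u => u.1.1 + u.1.2 < a ∧ u.1.1 - u.1.2 < a) :
    ray L a 0 (Sym2.map reflect s(x, y)) = 
      ray L a 0 s(x, y) * (plusSpin (dom L w) t x * plusSpin (dom L w) t y) *
        if sumA s(x, y) = -4 * L - 2 ∨ sumB s(x, y) = -4 * L - 2 then -1 else 1 := by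
  classical
  rw [mk_mem_bonds] at h
  obtain ⟨h, hm⟩ := h
  have hc := adj_cases h
  rw [ht, plusSpin_flipConfig, plusSpin_flipConfig]
  simp only [mem_dom] at *
  obtain ⟨p, hp⟩ := hp
  obtain ⟨k, hk⟩ := x.2
  obtain ⟨l, hl⟩ := y.2
  simp only [ray, Sym2.map_mk, reflect_val, sumA_mk, sumB_mk] at *
  clear ht h
  apply ite_neg_one_eq_mul <;>
    (generalize x.1.1 = b at *
     generalize x.1.2 = c at *
     generalize y.1.1 = b' at *
     generalize y.1.2 = c' at *
     rcases hc with ⟨rfl | rfl, rfl | rfl⟩ <;> intros <;> omega)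

/-! ### Order-disorder observables: local relations and vanishing on the axis. -/

/-- The correlation, in a finite domain, of a disorder at the face `(a, s)`, a spin at the site `x`,
a disorder at `(c, 0)` and a spin at `(2d, 0)`. The sign makes it a spinor in the upper
half-plane. -/
noncomputable def obs (L w c d a s : ℤ) (x : Site) : ℝ :=
  (if 2 * d < a - s then -1 else 1) *
    (twistedSum (dom L w) (fun e => ray L a s e * ray L c 0 e) (fun σ => σ x * σ (axisSite d)) /
      twistedSum (dom L w) 1 1)

theorem abs_obs_le_one (L w c d a s : ℤ) (x : Site) : |obs L w c d a s x| ≤ 1 := by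
  unfold obs
  rw [abs_mul, abs_div, abs_of_pos (twistedSum_one_pos _ _)]
  have h1 : |(if 2 * d < a - s then -1 else 1 : ℝ)| = 1 := by split_ifs <;> simp
  rw [h1, one_mul]
  refine div_le_one_of_le₀ (abs_twistedSum_le _ _ (fun e => ?_) _ _) (twistedSum_one_pos _ _).le
  rcases ray_eq_one_or L a s e with h | h <;> rcases ray_eq_one_or L c 0 e with h' | h' <;>
    simp [h, h']

theorem ray_eq_one_of_lt {L c : ℤ} {e : Sym2 Site} (h : sumB e < sumA e)
    (hL : -4 * L - 2 < sumA e) : ray L c 0 e = 1 := by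
  unfold ray
  rw [if_neg]
  omega

theorem axisSite_val (j : ℤ) : (axisSite j).1 = (2 * j, 0) := rfl

section Move

variable {L w c d a s : ℤ}

theorem obs_upRight_aux (hp : Odd (a + s)) (hs : 0 ≤ s) (hw : a < w) (h1 : -2 * L + 2 ≤ a - s)
    (h2 : a + s ≤ 2 * L - 2) {x y : Site}
    (hxy : s(x, y) = s(site a (s + 1), site (a + 1) s)) :
    obs L w c d (a + 1) (s + 1) x = √2 * obs L w c d a s x - obs L w c d a s y := by
  have hN : Even (a + (s + 1)) := by obtain ⟨k, hk⟩ := hp; exact ⟨k + 1, by omega⟩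
  have hE : Even (a + 1 + s) := by obtain ⟨k, hk⟩ := hp; exact ⟨k + 1, by omega⟩
  have hA : sumA s(x, y) = 2 * (a + s) + 2 := by
    rw [hxy]
    simp only [sumA_mk, site_fst hN, site_fst hE, site_snd hN, site_snd hE]
    ring
  have hB : sumB s(x, y) = 2 * (a - s) := by
    rw [hxy]
    simp only [sumB_mk, site_fst hN, site_fst hE, site_snd hN, site_snd hE]
    ring
  have hb : s(x, y) ∈ bonds (dom L w) := by
    rw [hxy, mk_mem_bonds]
    refine ⟨site_adj hN hE (by simp) (by simp), Or.inl ?_⟩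
    rw [mem_dom, site_fst hN, site_snd hN]
    omega
  have hr : ray L a s s(x, y) = 1 := by unfold ray; rw [if_neg]; omega
  have hc : ray L c 0 s(x, y) = 1 := ray_eq_one_of_lt (by omega) (by omega)
  have hm := twistedSum_move (ε := fun e => ray L a s e * ray L c 0 e)
    (ε' := fun e => ray L (a + 1) (s + 1) e * ray L c 0 e) (1 : dom L w → ℤˣ) (axisSite d) hb
    (by simp [hr, hc])
    (by
      have := ray_upRight hp (mk_mem_bonds.mp hb).1 (L := L) (by omega)
      rw [if_pos hxy] at this
      rw [this, hr, hc, ← spinHom_apply, ← spinHom_apply, map_one, map_one]; ring)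
    (by
      intro e he hne
      rw [← bondHom_apply, map_one, mul_one]
      congr 1
      induction e using Sym2.ind with
      | _ u v =>
        rw [ray_upRight hp (mk_mem_bonds.mp he).1 (by omega), if_neg (hxy ▸ hne)])
  have h1' : ∀ u, plusSpin (dom L w) 1 u = 1 := fun u => map_one (spinHom (dom L w) u)
  rw [h1', h1', hr, hc] at hm
  unfold obs
  rw [hm, show a + 1 - (s + 1) = a - s by ring]
  ring

theorem obs_upLeft_aux (hp : Odd (a + s)) (hs : 0 ≤ s) (hw : a ≤ w) (hd : 2 * d ≤ w)
    (h1 : -2 * L + 2 ≤ a - s) (h2 : a + s ≤ 2 * L - 2) {x y : Site} {δ : ℝ}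
    (hxy : s(x, y) = s(site (a - 1) s, site a (s + 1)))
    (hδ : δ = if x = site (a - 1) s then -1 else 1) :
    obs L w c d (a - 1) (s + 1) x = δ * (√2 * obs L w c d a s x - obs L w c d a s y) := by
  classical
  have hN : Even (a + (s + 1)) := by obtain ⟨k, hk⟩ := hp; exact ⟨k + 1, by omega⟩
  have hW : Even (a - 1 + s) := by obtain ⟨k, hk⟩ := hp; exact ⟨k, by omega⟩
  have hA : sumA s(x, y) = 2 * (a + s) := by
    rw [hxy]
    simp only [sumA_mk, site_fst hN, site_fst hW, site_snd hN, site_snd hW]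
    ring
  have hB : sumB s(x, y) = 2 * (a - s) - 2 := by
    rw [hxy]
    simp only [sumB_mk, site_fst hN, site_fst hW, site_snd hN, site_snd hW]
    ring
  have hb : s(x, y) ∈ bonds (dom L w) := by
    rw [hxy, mk_mem_bonds]
    refine ⟨site_adj hW hN (by simp) (by simp), Or.inl ?_⟩
    rw [mem_dom, site_fst hW, site_snd hW]
    omega
  have hr : ray L a s s(x, y) = 1 := by unfold ray; rw [if_neg]; omega
  have hc : ray L c 0 s(x, y) = 1 := ray_eq_one_of_lt (by omega) (by omega)
  obtain ⟨t, ht⟩ : ∃ t, t = flipConfig (dom L w)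
    fun u => u.1.1 - u.1.2 = a - s - 1 ∧ u.1.1 + u.1.2 < a + s := ⟨_, rfl⟩
  have hm := twistedSum_move (ε := fun e => ray L a s e * ray L c 0 e)
    (ε' := fun e => ray L (a - 1) (s + 1) e * ray L c 0 e) t (axisSite d) hb
    (by simp [hr, hc])
    (by
      have := ray_upLeft hp hb (by omega) (by omega) (by omega) (by omega) hw t ht
      rw [if_pos hxy] at this
      rw [this, hr, hc]; ring)
    (by
      intro e he hne
      induction e using Sym2.ind with
      | _ u v =>
        rw [ray_upLeft hp he (by omega) (by omega) (by omega) (by omega) hw t ht,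
          if_neg (hxy ▸ hne)]
        simp only [Sym2.map_mk, Sym2.mul_mk]
        ring)
  have htx : plusSpin (dom L w) t x = δ := by
    rw [hδ, ht, plusSpin_flipConfig]
    rw [Sym2.eq_iff] at hxy
    rcases hxy with ⟨rfl, rfl⟩ | ⟨rfl, rfl⟩
    · rw [if_pos rfl, if_pos]
      rw [mem_dom, site_fst hW, site_snd hW]
      omega
    · rw [if_neg, if_neg]
      · intro h
        have := site_fst hN
        rw [h, site_fst hW] at this
        omega
      · rw [mem_dom, site_fst hN, site_snd hN]
        omega
  -- The sliding line sweeps over the fixed spin exactly when `a - s = 2 * d + 1`; the sign in `obs`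
  -- jumps at the same moment and compensates.
  have htd : (if 2 * d < a - 1 - (s + 1) then -1 else 1) * plusSpin (dom L w) t (axisSite d)
      = if 2 * d < a - s then (-1 : ℝ) else 1 := by
    obtain ⟨p, hp⟩ := hp
    rw [ht, plusSpin_flipConfig]
    simp only [mem_dom, axisSite_val]
    by_cases hcase : a - s = 2 * d + 1
    · rw [if_neg (by omega), if_pos (by omega), if_pos (by omega)]; norm_num
    · rw [mul_comm, if_neg (by omega), one_mul]
      exact if_congr (by omega) rfl rfl
  rw [htx, hr, hc] at hm
  unfold obs
  rw [hm, ← htd]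
  ring

theorem obs_upRight_right (hp : Odd (a + s)) (hs : 0 ≤ s) (hw : a < w) (h1 : -2 * L + 2 ≤ a - s)
    (h2 : a + s ≤ 2 * L - 2) :
    obs L w c d (a + 1) (s + 1) (site (a + 1) s)
      = √2 * obs L w c d a s (site (a + 1) s) - obs L w c d a s (site a (s + 1)) :=
  obs_upRight_aux hp hs hw h1 h2 Sym2.eq_swap

theorem obs_upRight_up (hp : Odd (a + s)) (hs : 0 ≤ s) (hw : a < w) (h1 : -2 * L + 2 ≤ a - s)
    (h2 : a + s ≤ 2 * L - 2) :
    obs L w c d (a + 1) (s + 1) (site a (s + 1))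
      = √2 * obs L w c d a s (site a (s + 1)) - obs L w c d a s (site (a + 1) s) :=
  obs_upRight_aux hp hs hw h1 h2 rfl

theorem obs_upLeft_left (hp : Odd (a + s)) (hs : 0 ≤ s) (hw : a ≤ w) (hd : 2 * d ≤ w)
    (h1 : -2 * L + 2 ≤ a - s) (h2 : a + s ≤ 2 * L - 2) :
    obs L w c d (a - 1) (s + 1) (site (a - 1) s)
      = obs L w c d a s (site a (s + 1)) - √2 * obs L w c d a s (site (a - 1) s) := by
  rw [obs_upLeft_aux hp hs hw hd h1 h2 (x := site (a - 1) s) rfl (if_pos rfl).symm]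
  ring

theorem obs_upLeft_up (hp : Odd (a + s)) (hs : 0 ≤ s) (hw : a ≤ w) (hd : 2 * d ≤ w)
    (h1 : -2 * L + 2 ≤ a - s) (h2 : a + s ≤ 2 * L - 2) :
    obs L w c d (a - 1) (s + 1) (site a (s + 1))
      = √2 * obs L w c d a s (site a (s + 1)) - obs L w c d a s (site (a - 1) s) := by
  have hne : site a (s + 1) ≠ site (a - 1) s := by
    have hN : Even (a + (s + 1)) := by obtain ⟨k, hk⟩ := hp; exact ⟨k + 1, by omega⟩
    have hW : Even (a - 1 + s) := by obtain ⟨k, hk⟩ := hp; exact ⟨k, by omega⟩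
    intro h
    have := site_fst hN
    rw [h, site_fst hW] at this
    omega
  rw [obs_upLeft_aux hp hs hw hd h1 h2 Sym2.eq_swap (if_neg hne).symm]
  ring

/-- The vanishing of the correlations that change sign under the reflection in the axis. -/
theorem obs_axis_eq_zero (hpa : Odd a) (hpc : Odd c) (ha : -2 * L < a) (ha' : a ≤ 2 * L)
    (haw : a ≤ w) (hc : -2 * L < c) (hc' : c ≤ 2 * L) (hcw : c ≤ w) {b : ℤ} (hb : Even b)
    (hsign : ∀ t t' : dom L w → ℤˣ,
      t = flipConfig (dom L w) (fun u => u.1.1 + u.1.2 < a ∧ u.1.1 - u.1.2 < a) →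
      t' = flipConfig (dom L w) (fun u => u.1.1 + u.1.2 < c ∧ u.1.1 - u.1.2 < c) →
      plusSpin (dom L w) (t * t') (site b 0) * plusSpin (dom L w) (t * t') (axisSite d) = -1) :
    obs L w c d a 0 (site b 0) = 0 := by
  obtain ⟨t, ht⟩ : ∃ t, t = flipConfig (dom L w)
    fun u => u.1.1 + u.1.2 < a ∧ u.1.1 - u.1.2 < a := ⟨_, rfl⟩
  obtain ⟨t', ht'⟩ : ∃ t, t = flipConfig (dom L w)
    fun u => u.1.1 + u.1.2 < c ∧ u.1.1 - u.1.2 < c := ⟨_, rfl⟩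
  -- Reflecting an axis disorder line flips, on the axis, the sites to the left of its face, up to
  -- tails that cancel between the two lines. Together the lines flip the axis sites between their
  -- faces; if exactly one of the two spins is there, the sum equals its own negative.
  have h1 := twistedSum_gauge (ε := fun e => ray L a 0 e * ray L c 0 e)
    (ε' := fun e => ray L a 0 (e.map reflect) * ray L c 0 (e.map reflect)) (t * t') (site b 0)
    (axisSite d) (by
      intro e he
      rw [← bondHom_apply, map_mul, bondHom_apply, bondHom_apply]
      induction e using Sym2.ind with
      | _ x y =>
        rw [ray_reflect hpa he ha ha' haw t ht, ray_reflect hpc he hc hc' hcw t' ht']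
        simp only [Sym2.map_mk, Sym2.mul_mk]
        have h3 : ∀ r : ℝ, r = 1 ∨ r = -1 → r * r = 1 := by rintro r (rfl | rfl) <;> norm_num
        have h4 := h3 (if sumA s(x, y) = -4 * L - 2 ∨ sumB s(x, y) = -4 * L - 2 then -1 else 1)
          (by split_ifs <;> simp)
        linear_combination (ray L a 0 s(x, y) * (plusSpin (dom L w) t x * plusSpin (dom L w) t y) *
          (ray L c 0 s(x, y) * (plusSpin (dom L w) t' x * plusSpin (dom L w) t' y))) * h4)
  have h2 := twistedSum_map (Λ := dom L w) (Λ' := dom L w) reflect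
    (fun x => ⟨fun h => reflect.left_inv x ▸ reflect_mem_dom h,
      reflect_mem_dom⟩) reflect_adj reflect_adj
    (fun e => ray L a 0 e * ray L c 0 e) (fun σ => σ (site b 0) * σ (axisSite d))
  have h3 : reflect.symm (site b 0) = site b 0 := by
    apply Subtype.ext
    rw [reflect_symm, reflect_val, site_val (by rwa [add_zero])]
    simp
  have h4 : reflect.symm (axisSite d) = axisSite d := by
    apply Subtype.ext
    rw [reflect_symm, reflect_val]
    simp [axisSite]
  simp only [Function.comp_apply, h3, h4] at h2
  rw [h2, hsign t t' ht ht'] at h1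
  have h5 : twistedSum (dom L w) (fun e => ray L a 0 e * ray L c 0 e)
    (fun σ => σ (site b 0) * σ (axisSite d)) = 0 := by linarith
  rw [obs, h5]
  simp

/-- Here and in the next two lemmas exactly one of the two spins lies between the two disorders. -/
theorem obs_right_eq_zero_of_lt (hpa : Odd a) (hpc : Odd c) (ha : -2 * L < a) (hac : a < c)
    (hcd : c < 2 * d) (hd : 2 * d ≤ w) (hL : 2 * d ≤ 2 * L) :
    obs L w c d a 0 (site (a + 1) 0) = 0 := by
  classical
  obtain ⟨p, hp⟩ := hpa
  obtain ⟨q, hq⟩ := hpc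
  have he : Even (a + 1) := ⟨p + 1, by omega⟩
  refine obs_axis_eq_zero ⟨p, hp⟩ ⟨q, hq⟩ ha (by omega) (by omega) (by omega) (by omega) (by omega)
    he fun t t' ht ht' => ?_
  have he' : Even (a + 1 + 0) := by rwa [add_zero]
  rw [plusSpin_mul, plusSpin_mul, ht, ht']
  simp only [plusSpin_flipConfig, mem_dom, site_fst he', site_snd he', axisSite_val]
  rw [if_neg (by omega), if_pos (by omega), if_neg (by omega), if_neg (by omega)]
  norm_num

theorem obs_right_eq_zero_of_gt (hpa : Odd a) (hpc : Odd c) (hc : -2 * L < c) (hcd : c < 2 * d)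
    (hda : 2 * d < a) (haw : a ≤ w) (haL : a ≤ 2 * L) :
    obs L w c d a 0 (site (a + 1) 0) = 0 := by
  classical
  obtain ⟨p, hp⟩ := hpa
  obtain ⟨q, hq⟩ := hpc
  have he : Even (a + 1) := ⟨p + 1, by omega⟩
  refine obs_axis_eq_zero ⟨p, hp⟩ ⟨q, hq⟩ (by omega) (by omega) (by omega) (by omega) (by omega)
    (by omega) he fun t t' ht ht' => ?_
  have he' : Even (a + 1 + 0) := by rwa [add_zero]
  rw [plusSpin_mul, plusSpin_mul, ht, ht']
  simp only [plusSpin_flipConfig, mem_dom, site_fst he', site_snd he', axisSite_val]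
  rw [if_neg (by omega), if_neg (by omega), if_pos (by omega), if_neg (by omega)]
  norm_num

theorem obs_left_eq_zero (hpa : Odd a) (hpc : Odd c) (hc : -2 * L < c) (hca : c < a)
    (had : a < 2 * d) (hd : 2 * d ≤ w) (hL : 2 * d ≤ 2 * L) :
    obs L w c d a 0 (site (a - 1) 0) = 0 := by
  classical
  obtain ⟨p, hp⟩ := hpa
  obtain ⟨q, hq⟩ := hpc
  have he : Even (a - 1) := ⟨p, by omega⟩
  refine obs_axis_eq_zero ⟨p, hp⟩ ⟨q, hq⟩ (by omega) (by omega) (by omega) (by omega) (by omega)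
    (by omega) he fun t t' ht ht' => ?_
  have he' : Even (a - 1 + 0) := by rwa [add_zero]
  rw [plusSpin_mul, plusSpin_mul, ht, ht']
  simp only [plusSpin_flipConfig, mem_dom, site_fst he', site_snd he', axisSite_val]
  rw [if_pos (by omega), if_neg (by omega), if_neg (by omega), if_neg (by omega)]
  norm_num

/-- Coinciding disorder lines cancel, which is how spin correlations enter. -/
theorem obs_self (hcd : c ≤ 2 * d) (x : Site) :
    obs L w c d c 0 x = plusExp θcrit (dom L w) fun σ => σ x * σ (axisSite d) := by
  rw [obs, if_neg (by omega), one_mul, plusExp_eq_twistedSum]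
  simp only [ray_mul_self]
  rfl

end Move

/-! ### Bounded discrete harmonic functions in the upper half-plane. -/

/-- A bounded function on the upper half-plane that is discrete harmonic, for the walk with diagonal
steps, and vanishes on the boundary, vanishes on the adjacent row. -/
theorem harmonic_eq_zero {h : ℤ → ℕ → ℝ} {C : ℝ} (hb : ∀ a s, |h a s| ≤ C)
    (harm : ∀ a s, 4 * h a (s + 1) = h (a + 1) (s + 2) + h (a - 1) (s + 2) + h (a + 1) s
      + h (a - 1) s)
    (h0 : ∀ a, h a 0 = 0) (a : ℤ) : h a 1 = 0 := by
  set m : ℕ → ℝ := fun s => ⨆ a, |h a s| with hm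
  have hbdd : ∀ s, BddAbove (Set.range fun a => |h a s|) := fun s =>
    ⟨C, by rintro _ ⟨a, rfl⟩; exact hb a s⟩
  have hle : ∀ a s, |h a s| ≤ m s := fun a s => le_ciSup (hbdd s) a
  have hmC : ∀ s, m s ≤ C := fun s => ciSup_le fun a => hb a s
  have hm0 : m 0 = 0 := by simp [hm, h0]
  -- The row suprema are convex in `s`, vanish at `0` and are bounded, so the first one cannot be
  -- positive.
  have hconv : ∀ s, 2 * m (s + 1) ≤ m (s + 2) + m s := by
    intro s
    have : m (s + 1) ≤ (m (s + 2) + m s) / 2 := by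
      refine ciSup_le fun a => ?_
      have h1 := abs_le.mp (hle (a + 1) (s + 2))
      have h2 := abs_le.mp (hle (a - 1) (s + 2))
      have h3 := abs_le.mp (hle (a + 1) s)
      have h4 := abs_le.mp (hle (a - 1) s)
      have h5 := harm a s
      rw [abs_le]
      constructor <;> linarith [h1.1, h1.2, h2.1, h2.2, h3.1, h3.2, h4.1, h4.2]
    linarith
  have hinc : ∀ s, m 1 ≤ m (s + 1) - m s := by
    intro s
    induction s with
    | zero => simp [hm0]
    | succ s ih => linarith [hconv s]
  have hlin : ∀ s : ℕ, s * m 1 ≤ m s := by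
    intro s
    induction s with
    | zero => simp [hm0]
    | succ s ih => push_cast; linarith [hinc s]
  have hm1 : m 1 ≤ 0 := by
    by_contra! hpos
    obtain ⟨N, hN⟩ := exists_nat_gt (C / m 1)
    rw [div_lt_iff₀ hpos] at hN
    linarith [hlin N, hmC N]
  exact abs_nonpos_iff.mp ((hle a 1).trans hm1)

/-- The multiplier of the harmonic extension from a row to the next one. -/
noncomputable def multiplier (t : ℝ) : ℝ := (1 - Real.sin t) / Real.cos t

/-- The Poisson kernel of the upper half-plane for the walk with diagonal steps. -/
noncomputable def poisson (a : ℤ) (s : ℕ) : ℝ :=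
  (∫ t in 0..Real.pi, multiplier t ^ s * Real.cos (a * t)) / Real.pi

theorem multiplier_mul_cos {t : ℝ} (ht : t ∈ Set.Icc 0 Real.pi) :
    multiplier t * Real.cos t = 1 - Real.sin t := by
  have h0 : 0 ≤ Real.sin t := Real.sin_nonneg_of_mem_Icc ht
  by_cases hc : Real.cos t = 0
  · have h1 := Real.sin_sq_add_cos_sq t
    rw [hc] at h1
    have : Real.sin t = 1 := by nlinarith
    simp [hc, this]
  · rw [multiplier, div_mul_cancel₀ _ hc]

theorem abs_multiplier_le {t : ℝ} (ht : t ∈ Set.Icc 0 Real.pi) : |multiplier t| ≤ 1 := by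
  have h0 : 0 ≤ Real.sin t := Real.sin_nonneg_of_mem_Icc ht
  have h1 := Real.sin_sq_add_cos_sq t
  have h2 := Real.sin_le_one t
  rw [multiplier, abs_div]
  refine div_le_one_of_le₀ ?_ (abs_nonneg _)
  rw [← sq_le_sq]
  nlinarith

/-- This quadratic equation makes `multiplier t ^ s * cos (a * t)` harmonic; `multiplier` is its
root bounded by `1` on `[0, π]`. At `t = π / 2`, division by zero returns `0`, the correct limit. -/
theorem multiplier_sq (t : ℝ) :
    Real.cos t * (multiplier t ^ 2 + 1) = 2 * multiplier t := by
  by_cases hc : Real.cos t = 0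
  · simp [multiplier, hc]
  · have h1 := Real.sin_sq_add_cos_sq t
    rw [multiplier]
    field_simp
    linear_combination h1

theorem integrable_multiplier (s : ℕ) {f : ℝ → ℝ} (hf : Continuous f) :
    IntervalIntegrable (fun t => multiplier t ^ s * f t) MeasureTheory.volume 0 Real.pi := by
  refine IntervalIntegrable.mul_continuousOn ?_ hf.continuousOn
  rw [intervalIntegrable_iff_integrableOn_Icc_of_le Real.pi_pos.le]
  refine MeasureTheory.Measure.integrableOn_of_bounded (M := 1) (by simp) ?_ ?_
  · have : Measurable multiplier := by unfold multiplier; fun_prop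
    exact (this.pow_const s).aestronglyMeasurable
  · refine (MeasureTheory.ae_restrict_iff' measurableSet_Icc).mpr (Eventually.of_forall fun t ht => ?_)
    rw [Real.norm_eq_abs, abs_pow]
    exact pow_le_one₀ (abs_nonneg _) (abs_multiplier_le ht)

theorem abs_poisson_le (a : ℤ) (s : ℕ) : |poisson a s| ≤ 1 := by
  rw [poisson, abs_div, abs_of_pos Real.pi_pos, div_le_one Real.pi_pos]
  have := intervalIntegral.norm_integral_le_of_norm_le_const (a := 0) (b := Real.pi) (C := 1)
    (f := fun t => multiplier t ^ s * Real.cos (a * t)) (fun t ht => by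
      rw [Set.uIoc_of_le Real.pi_pos.le] at ht
      rw [Real.norm_eq_abs, abs_mul, abs_pow]
      exact mul_le_one₀ (pow_le_one₀ (abs_nonneg _) (abs_multiplier_le ⟨ht.1.le, ht.2⟩))
        (abs_nonneg _) (Real.abs_cos_le_one _))
  simpa [abs_of_pos Real.pi_pos] using this

theorem poisson_add (a : ℤ) (s : ℕ) : poisson (a + 1) s + poisson (a - 1) s
    = (∫ t in 0..Real.pi, multiplier t ^ s * (2 * Real.cos t * Real.cos (a * t))) / Real.pi := by
  rw [poisson, poisson, ← add_div, ← intervalIntegral.integral_add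
    (integrable_multiplier s (by fun_prop)) (integrable_multiplier s (by fun_prop))]
  congr 2
  funext t
  push_cast
  rw [add_mul, sub_mul, Real.cos_add, Real.cos_sub, one_mul]
  ring

theorem poisson_harmonic (a : ℤ) (s : ℕ) : 4 * poisson a (s + 1) = poisson (a + 1) (s + 2)
    + poisson (a - 1) (s + 2) + poisson (a + 1) s + poisson (a - 1) s := by
  rw [poisson_add, add_assoc, poisson_add, poisson, ← add_div, ← intervalIntegral.integral_add
    (integrable_multiplier _ (by fun_prop)) (integrable_multiplier _ (by fun_prop)), ← mul_div_assoc,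
    ← intervalIntegral.integral_const_mul]
  congr 1
  refine intervalIntegral.integral_congr fun t _ => ?_
  have := multiplier_sq t
  linear_combination (-2 * multiplier t ^ s * Real.cos (a * t)) * this

theorem integral_cos_int (a : ℤ) :
    ∫ t in 0..Real.pi, Real.cos (a * t) = if a = 0 then Real.pi else 0 := by
  split_ifs with h
  · simp [h]
  · have : (a : ℝ) ≠ 0 := by exact_mod_cast h
    rw [intervalIntegral.integral_comp_mul_left _ this]
    simp [Real.sin_int_mul_pi]

theorem poisson_zero (a : ℤ) : poisson a 0 = if a = 0 then 1 else 0 := by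
  simp only [poisson, pow_zero, one_mul, integral_cos_int]
  split_ifs <;> simp [Real.pi_ne_zero]

theorem two_mul_add_one_ne_zero (k : ℤ) : (2 * (k : ℝ) + 1) ≠ 0 := by
  have : 2 * k + 1 ≠ 0 := by omega
  exact_mod_cast this

theorem integral_sin_mul_cos (k : ℤ) :
    ∫ t in 0..Real.pi, Real.sin t * Real.cos (2 * k * t) = 2 / (1 - 4 * (k : ℝ) ^ 2) := by
  have h1 := two_mul_add_one_ne_zero k
  have h2 := two_mul_add_one_ne_zero (-k)
  push_cast at h2
  have hd : ∀ t ∈ Set.uIcc 0 Real.pi, HasDerivAt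
      (fun t => -(Real.cos ((2 * k + 1) * t) / (2 * (2 * k + 1))
        + Real.cos ((2 * (-k) + 1) * t) / (2 * (2 * (-k) + 1))))
      (Real.sin t * Real.cos (2 * k * t)) t := by
    intro t _
    have e1 := ((hasDerivAt_id t).const_mul (2 * (k : ℝ) + 1)).cos.div_const (2 * (2 * (k : ℝ) + 1))
    have e2 := ((hasDerivAt_id t).const_mul (2 * (-k : ℝ) + 1)).cos.div_const
      (2 * (2 * (-k : ℝ) + 1))
    refine (e1.add e2).neg.congr_deriv ?_
    simp only [id]
    have e3 : Real.sin ((2 * (k : ℝ) + 1) * t) = Real.sin t * Real.cos (2 * k * t)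
        + Real.cos t * Real.sin (2 * k * t) := by
      rw [show (2 * (k : ℝ) + 1) * t = t + 2 * k * t by ring, Real.sin_add]
    have e4 : Real.sin ((2 * (-k : ℝ) + 1) * t) = Real.sin t * Real.cos (2 * k * t)
        - Real.cos t * Real.sin (2 * k * t) := by
      rw [show (2 * (-k : ℝ) + 1) * t = t - 2 * k * t by ring, Real.sin_sub]
    rw [e3, e4]
    generalize 2 * (k : ℝ) + 1 = p at *
    generalize 2 * (-k : ℝ) + 1 = q at *
    field_simp
    ring
  rw [intervalIntegral.integral_eq_sub_of_hasDerivAt hd (by apply Continuous.intervalIntegrable; fun_prop)]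
  have c1 : Real.cos ((2 * (k : ℝ) + 1) * Real.pi) = -1 := by
    rw [show (2 * (k : ℝ) + 1) * Real.pi = Real.pi + k * (2 * Real.pi) by ring,
      Real.cos_add_int_mul_two_pi, Real.cos_pi]
  have c2 : Real.cos ((2 * (-k : ℝ) + 1) * Real.pi) = -1 := by
    rw [show (2 * (-k : ℝ) + 1) * Real.pi = Real.pi - k * (2 * Real.pi) by ring,
      Real.cos_sub_int_mul_two_pi, Real.cos_pi]
  rw [c1, c2]
  simp only [mul_zero, Real.cos_zero]
  have : 1 - 4 * (k : ℝ) ^ 2 = (2 * (k : ℝ) + 1) * (2 * (-k : ℝ) + 1) := by ring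
  have hpq : (2 * (k : ℝ) + 1) + (2 * (-k : ℝ) + 1) = 2 := by ring
  rw [this]
  generalize 2 * (k : ℝ) + 1 = p at *
  generalize 2 * (-k : ℝ) + 1 = q at *
  field_simp
  linear_combination 2 * hpq

/-- The Fourier coefficients of the weight `|sin t|`. -/
noncomputable def kernelCoeff (k : ℤ) : ℝ := 1 / (1 - 4 * (k : ℝ) ^ 2)

theorem kernelCoeff_neg (k : ℤ) : kernelCoeff (-k) = kernelCoeff k := by simp [kernelCoeff]

/-- Since `multiplier t * cos t = 1 - sin t` on `[0, π]`, the normal derivative has symbol `sin t`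
there. -/
theorem poisson_defect (k : ℤ) :
    poisson (2 * k) 0 - (poisson (2 * k + 1) 1 + poisson (2 * k - 1) 1) / 2
      = 2 / Real.pi * kernelCoeff k := by
  have hpi := Real.pi_ne_zero
  rw [poisson_add]
  have h1 : ∫ t in 0..Real.pi, multiplier t ^ 1 * (2 * Real.cos t * Real.cos ((2 * k : ℤ) * t))
      = 2 * ((∫ t in 0..Real.pi, Real.cos ((2 * k : ℤ) * t))
        - ∫ t in 0..Real.pi, Real.sin t * Real.cos (2 * k * t)) := by
    rw [← intervalIntegral.integral_sub (by apply Continuous.intervalIntegrable; fun_prop)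
      (by apply Continuous.intervalIntegrable; fun_prop), ← intervalIntegral.integral_const_mul]
    refine intervalIntegral.integral_congr fun t ht => ?_
    rw [Set.uIcc_of_le Real.pi_pos.le] at ht
    have := multiplier_mul_cos ht
    simp only [pow_one]
    push_cast
    linear_combination (2 * Real.cos (2 * k * t)) * this
  rw [h1, integral_sin_mul_cos, poisson]
  simp only [pow_zero, one_mul]
  rw [kernelCoeff]
  field_simp
  ring

/-- The normal derivative of the bounded harmonic extension of a finitely supported function. -/
theorem defect_eq_sum {h : ℤ → ℕ → ℝ} {C : ℝ} (hb : ∀ a s, |h a s| ≤ C)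
    (harm : ∀ a s, 4 * h a (s + 1) = h (a + 1) (s + 2) + h (a - 1) (s + 2) + h (a + 1) s
      + h (a - 1) s) (b : ℤ) (n : ℕ) (g : ℕ → ℝ)
    (h0 : ∀ a, h a 0 = ∑ j ∈ Finset.range n, g j * if a - b - 2 * j = 0 then 1 else 0) (i : ℤ) :
    h (b + 2 * i) 0 - (h (b + 2 * i + 1) 1 + h (b + 2 * i - 1) 1) / 2
      = ∑ j ∈ Finset.range n, g j * (2 / Real.pi * kernelCoeff (i - j)) := by
  -- Subtracting the Poisson extension leaves zero boundary values, so `harmonic_eq_zero` applies.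
  set u : ℤ → ℕ → ℝ := fun a s => h a s - ∑ j ∈ Finset.range n, g j * poisson (a - b - 2 * j) s
    with hu
  have hub : ∀ a s, |u a s| ≤ C + ∑ j ∈ Finset.range n, |g j| := by
    intro a s
    refine (abs_sub _ _).trans (add_le_add (hb a s) ((Finset.abs_sum_le_sum_abs _ _).trans ?_))
    refine Finset.sum_le_sum fun j _ => ?_
    rw [abs_mul]
    exact mul_le_of_le_one_right (abs_nonneg _) (abs_poisson_le _ _)
  have huh : ∀ a s, 4 * u a (s + 1) = u (a + 1) (s + 2) + u (a - 1) (s + 2) + u (a + 1) s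
      + u (a - 1) s := by
    intro a s
    have e : ∑ j ∈ Finset.range n, 4 * (g j * poisson (a - b - 2 * j) (s + 1))
        = ∑ j ∈ Finset.range n, (g j * poisson (a + 1 - b - 2 * j) (s + 2)
          + g j * poisson (a - 1 - b - 2 * j) (s + 2) + g j * poisson (a + 1 - b - 2 * j) s
          + g j * poisson (a - 1 - b - 2 * j) s) := by
      refine Finset.sum_congr rfl fun j _ => ?_
      have := poisson_harmonic (a - b - 2 * j) s
      rw [show a - b - 2 * (j : ℤ) + 1 = a + 1 - b - 2 * j by ring,
        show a - b - 2 * (j : ℤ) - 1 = a - 1 - b - 2 * j by ring] at this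
      linear_combination g j * this
    rw [← Finset.mul_sum, Finset.sum_add_distrib, Finset.sum_add_distrib,
      Finset.sum_add_distrib] at e
    simp only [hu]
    linear_combination harm a s - e
  have hu0 : ∀ a, u a 0 = 0 := by
    intro a
    simp only [hu, h0, poisson_zero, sub_self]
  have h1 : ∀ a, h a 1 = ∑ j ∈ Finset.range n, g j * poisson (a - b - 2 * j) 1 := fun a =>
    sub_eq_zero.mp (harmonic_eq_zero hub huh hu0 a)
  rw [h0, h1, h1, ← Finset.sum_add_distrib, Finset.sum_div, ← Finset.sum_sub_distrib]
  refine Finset.sum_congr rfl fun j _ => ?_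
  rw [← poisson_defect, ← poisson_zero, show b + 2 * i - b - 2 * (j : ℤ) = 2 * (i - j) by ring,
    show b + 2 * i + 1 - b - 2 * (j : ℤ) = 2 * (i - j) + 1 by ring,
    show b + 2 * i - 1 - b - 2 * (j : ℤ) = 2 * (i - j) - 1 by ring]
  ring

/-! ### Orthogonal polynomials and the Toeplitz system. -/

/-- The Taylor coefficients of `(1 - z) ^ (-1 / 2)`. -/
noncomputable def halfCoeff (k : ℕ) : ℝ := ∏ i ∈ Finset.range k, (2 * (i : ℝ) + 1) / (2 * i + 2)

theorem halfCoeff_pos (k : ℕ) : 0 < halfCoeff k := Finset.prod_pos fun i _ => by positivity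

theorem halfCoeff_succ (k : ℕ) : (2 * (k : ℝ) + 2) * halfCoeff (k + 1)
    = (2 * k + 1) * halfCoeff k := by
  rw [halfCoeff, Finset.prod_range_succ, ← halfCoeff]
  have : 2 * (k : ℝ) + 2 ≠ 0 := by positivity
  field_simp

/-- The coefficients of the orthogonal polynomials on the unit circle for the weight `|1 - z|`. -/
noncomputable def polyCoeff (n j : ℕ) : ℝ := halfCoeff (n - j) * ((2 * j + 1) * halfCoeff j)

/-- The numbers `(2 * j + 1) * halfCoeff j` are the Taylor coefficients of `(1 - z) ^ (-3 / 2)`, so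
consecutive coefficients have a rational ratio; `momentSum_rec` telescopes by it. -/
theorem polyCoeff_succ {n j : ℕ} (hj : j < n) :
    (2 * n - 1 - 2 * j) * ((j + 1) * polyCoeff n (j + 1))
      = (2 * j + 3) * ((n - j) * polyCoeff n j) := by
  obtain ⟨k, rfl⟩ : ∃ k, n = j + 1 + k := ⟨n - (j + 1), by omega⟩
  simp only [polyCoeff]
  rw [show j + 1 + k - (j + 1) = k by omega, show j + 1 + k - j = k + 1 by omega]
  have h1 := halfCoeff_succ j
  have h2 := halfCoeff_succ k
  push_cast
  linear_combination (2 * (k : ℝ) + 1) * (2 * j + 3) / 2 * halfCoeff k * h1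
    - (2 * (j : ℝ) + 3) * (2 * j + 1) / 2 * halfCoeff j * h2

/-- The Fourier coefficients of the product of the orthogonal polynomial and the weight. -/
noncomputable def momentSum (n : ℕ) (i : ℤ) : ℝ :=
  ∑ j ∈ Finset.range (n + 1), polyCoeff n j * kernelCoeff (i - j)

/-- Creative telescoping with certificate `T`: the difference of the two sides collapses because `T
0` has the factor `j = 0` and the last numerator the factor `n - j = 0`. -/
theorem momentSum_rec (n : ℕ) (i : ℤ) :
    (2 * (i : ℝ) + 3) * (i + 1 - n) * momentSum n (i + 1)
      = (2 * i - 2 * n - 1) * (i + 1) * momentSum n i := by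
  have hk : ∀ m : ℤ, kernelCoeff m = 1 / ((2 * m + 1) * (1 - 2 * m)) := by
    intro m; rw [kernelCoeff]; congr 1; ring
  set T : ℕ → ℝ := fun j => -(j * ((2 * n + 1 - 2 * j) * polyCoeff n j)) /
    ((2 * (i - j) + 3) * (2 * (i - j) + 1)) with hT
  have hterm : ∀ j : ℕ, (2 * (i : ℝ) + 3) * (i + 1 - n) * (polyCoeff n j * kernelCoeff (i + 1 - j))
      - (2 * i - 2 * n - 1) * (i + 1) * (polyCoeff n j * kernelCoeff (i - j))
      = -((2 * j + 3) * ((n - j) * polyCoeff n j)) / ((2 * (i - j) + 1) * (2 * (i - j) - 1))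
        - T j := by
    intro j
    have h1 := two_mul_add_one_ne_zero (i - j)
    have h2 := two_mul_add_one_ne_zero (i - j + 1)
    have h3 := two_mul_add_one_ne_zero (i - j - 1)
    push_cast at h1 h2 h3
    rw [hk, hk]
    simp only [hT]
    push_cast
    have e1 : (2 * ((i : ℝ) + 1 - j) + 1) = 2 * (i - j) + 3 := by ring
    have e2 : (1 - 2 * ((i : ℝ) + 1 - j)) = -(2 * (i - j) + 1) := by ring
    have e3 : (1 - 2 * ((i : ℝ) - j)) = -(2 * (i - j) - 1) := by ring
    rw [show 2 * ((i : ℝ) - j + 1) + 1 = 2 * (i - j) + 3 by ring] at h2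
    rw [show 2 * ((i : ℝ) - j - 1) + 1 = 2 * (i - j) - 1 by ring] at h3
    rw [e1, e2, e3]
    obtain ⟨m, hm⟩ : ∃ m : ℝ, m = i - j := ⟨_, rfl⟩
    rw [← hm] at h1 h2 h3 ⊢
    have hi : (i : ℝ) = m + j := by linarith
    rw [hi]
    field_simp
    ring
  have hstep : ∀ j < n, -((2 * j + 3) * ((n - j) * polyCoeff n j))
      / ((2 * (i - j) + 1) * (2 * (i - j) - 1)) = T (j + 1) := by
    intro j hj
    rw [← polyCoeff_succ hj]
    simp only [hT]
    push_cast
    congr 1 <;> ring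
  rw [← sub_eq_zero, momentSum, momentSum, Finset.mul_sum, Finset.mul_sum,
    ← Finset.sum_sub_distrib, Finset.sum_congr rfl fun j _ => hterm j, Finset.sum_range_succ,
    Finset.sum_congr rfl fun j hj => by rw [hstep j (Finset.mem_range.mp hj)],
    Finset.sum_range_sub]
  simp [hT]

/-- At `i = n - 1` the left side of `momentSum_rec` has the factor `i + 1 - n = 0`; the recursion
then carries the zero down to smaller `i`. -/
theorem momentSum_eq_zero (n : ℕ) (i : ℕ) (hi : i < n) : momentSum n i = 0 := by
  have key : ∀ k : ℕ, ∀ i : ℕ, i + k + 1 = n → momentSum n i = 0 := by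
    intro k
    induction k with
    | zero =>
      intro i hi
      have h := momentSum_rec n i
      have h1 : (i : ℝ) + 1 - n = 0 := by rw [← hi]; push_cast; ring
      have h2 : (n : ℝ) = i + 1 := by linarith
      push_cast at h
      rw [h1, h2] at h
      have h3 : (2 * (i : ℝ) - 2 * (i + 1) - 1) * (i + 1) ≠ 0 := by
        apply mul_ne_zero
        · ring_nf; norm_num
        · positivity
      have := mul_eq_zero.mp (h.symm.trans (by ring))
      exact this.resolve_left h3
    | succ k ih =>
      intro i hi
      have h := momentSum_rec n i
      have h0 := ih (i + 1) (by omega)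
      push_cast at h h0
      rw [h0, mul_zero] at h
      have h2 : (n : ℝ) = i + k + 2 := by rw [← hi]; push_cast; ring
      have h3 : (2 * (i : ℝ) - 2 * n - 1) * (i + 1) ≠ 0 := by
        rw [h2]
        have hk : (0 : ℝ) ≤ k := k.cast_nonneg
        apply mul_ne_zero
        · intro hh; linarith
        · positivity
      exact (mul_eq_zero.mp h.symm).resolve_left h3
  exact key (n - i - 1) i (by omega)

/-- Szegő's recursion, relating a polynomial and its reversal to the one of lower degree. -/
theorem polyCoeff_reverse (n j : ℕ) (hj : j ≤ n) :
    (2 * (n : ℝ) + 3) * polyCoeff (n + 1) (j + 1) - polyCoeff (n + 1) (n - j)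
      = (2 * n + 4) * polyCoeff n j := by
  obtain ⟨k, rfl⟩ : ∃ k, n = j + k := ⟨n - j, by omega⟩
  simp only [polyCoeff]
  rw [show j + k + 1 - (j + 1) = k by omega, show j + k - j = k by omega,
    show j + k + 1 - k = j + 1 by omega]
  have h1 := halfCoeff_succ j
  push_cast
  linear_combination (2 * (j + k : ℝ) + 4) * halfCoeff k * h1

theorem sum_reverse_eq (n : ℕ) (f : ℕ → ℝ) (i : ℤ) :
    ∑ j ∈ Finset.range (n + 1), f (n - j) * kernelCoeff (i - j)
      = ∑ j ∈ Finset.range (n + 1), f j * kernelCoeff (n - i - j) := by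
  rw [← Finset.sum_range_reflect]
  refine Finset.sum_congr rfl fun j hj => ?_
  have hj' : j ≤ n := by have := Finset.mem_range.mp hj; omega
  rw [show n + 1 - 1 - j = n - j by omega, show n - (n - j) = j by omega, ← kernelCoeff_neg,
    Nat.cast_sub hj']
  congr 2
  ring

/-- Szegő's recursion is paired with the kernel; the reversed polynomial contributes `momentSum (n +
1) 0`, which is zero by orthogonality. -/
theorem momentSum_succ_self (n : ℕ) :
    (2 * (n : ℝ) + 3) * momentSum (n + 1) (n + 1 : ℕ) = (2 * n + 4) * momentSum n n := by
  have h0 := momentSum_eq_zero (n + 1) 0 (by omega)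
  have h1 := sum_reverse_eq (n + 1) (polyCoeff (n + 1)) (n + 1 : ℕ)
  rw [sub_self] at h1
  rw [momentSum, Nat.cast_zero] at h0
  rw [h0, Finset.sum_range_succ'] at h1
  rw [momentSum, momentSum, Finset.sum_range_succ']
  have h2 : ∑ j ∈ Finset.range (n + 1), ((2 * (n : ℝ) + 3) *
      (polyCoeff (n + 1) (j + 1) * kernelCoeff ((n + 1 : ℕ) - (j + 1 : ℕ)))
      - polyCoeff (n + 1) (n + 1 - (j + 1)) * kernelCoeff ((n + 1 : ℕ) - (j + 1 : ℕ)))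
      = ∑ j ∈ Finset.range (n + 1), (2 * (n : ℝ) + 4) * (polyCoeff n j * kernelCoeff (n - j)) := by
    refine Finset.sum_congr rfl fun j hj => ?_
    have hj' : j ≤ n := by have := Finset.mem_range.mp hj; omega
    rw [show n + 1 - (j + 1) = n - j by omega,
      show ((n + 1 : ℕ) : ℤ) - (j + 1 : ℕ) = n - j by push_cast; ring]
    linear_combination kernelCoeff (n - j) * polyCoeff_reverse n j hj'
  rw [Finset.sum_sub_distrib, ← Finset.mul_sum, ← Finset.mul_sum] at h2
  have h3 : (2 * (n : ℝ) + 3) * polyCoeff (n + 1) 0 = polyCoeff (n + 1) (n + 1) := by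
    have h4 : halfCoeff 0 = 1 := by simp [halfCoeff]
    simp only [polyCoeff, Nat.sub_zero, Nat.sub_self, h4]
    push_cast
    ring
  rw [Nat.sub_zero, ← h3] at h1
  linear_combination h2 + h1

theorem momentSum_self (n : ℕ) :
    momentSum n n = halfCoeff n * ((n + 1) * Real.Wallis.W n) := by
  induction n with
  | zero => simp [momentSum, polyCoeff, halfCoeff, kernelCoeff, Real.Wallis.W]
  | succ n ih =>
    have h := momentSum_succ_self n
    have h1 := halfCoeff_succ n
    rw [ih] at h
    rw [Real.Wallis.W_succ]
    have h3 : (2 * (n : ℝ) + 3) ≠ 0 := by positivity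
    have h4 : (2 * (n : ℝ) + 1) ≠ 0 := by positivity
    have h5 : halfCoeff n = (2 * n + 2) / (2 * n + 1) * halfCoeff (n + 1) := by
      field_simp
      linear_combination -h1
    apply mul_left_cancel₀ h3
    rw [h, h5]
    push_cast
    field_simp
    ring

/-- The solution of the Toeplitz system for the weight `|1 - z|`. -/
theorem toeplitz_last {n : ℕ} {g : ℕ → ℝ} {x y : ℝ}
    (h : ∀ i ∈ Finset.range (n + 1), ∑ j ∈ Finset.range (n + 1),
        g j * (2 / Real.pi * kernelCoeff (i - j))
      = ((if i = 0 then x else 0) + if i = n then y else 0) / 2) :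
    x + (2 * n + 1) * y = 4 / Real.pi * ((n + 1) * Real.Wallis.W n) * g n := by
  -- Pairing with `polyCoeff n` eliminates every unknown but `g n`. The end coefficients `halfCoeff
  -- n` and `(2 * n + 1) * halfCoeff n` account for the left side of the claim.
  have h1 : ∑ i ∈ Finset.range (n + 1), polyCoeff n i * ∑ j ∈ Finset.range (n + 1),
      g j * (2 / Real.pi * kernelCoeff (i - j)) = 2 / Real.pi * (g n * momentSum n n) := by
    simp only [Finset.mul_sum]
    rw [Finset.sum_comm]
    have h2 : ∀ j ∈ Finset.range (n + 1), ∑ i ∈ Finset.range (n + 1),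
        polyCoeff n i * (g j * (2 / Real.pi * kernelCoeff (i - j)))
        = 2 / Real.pi * (g j * momentSum n j) := by
      intro j _
      rw [momentSum, Finset.mul_sum, Finset.mul_sum]
      refine Finset.sum_congr rfl fun i _ => ?_
      rw [← kernelCoeff_neg, neg_sub]
      ring
    rw [Finset.sum_congr rfl h2, Finset.sum_range_succ, Finset.sum_eq_zero, zero_add]
    intro j hj
    rw [momentSum_eq_zero n j (Finset.mem_range.mp hj)]
    simp
  rw [Finset.sum_congr rfl fun i hi => by rw [h i hi], momentSum_self] at h1
  have h3 : ∑ i ∈ Finset.range (n + 1), polyCoeff n i *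
      (((if i = 0 then x else 0) + if i = n then y else 0) / 2)
      = halfCoeff n * (x + (2 * n + 1) * y) / 2 := by
    simp only [add_div, mul_add, Finset.sum_add_distrib, ite_div, zero_div, mul_ite, mul_zero]
    rw [Finset.sum_ite_eq' , Finset.sum_ite_eq']
    simp [polyCoeff, halfCoeff]
    ring
  rw [h3] at h1
  have := halfCoeff_pos n
  apply mul_left_cancel₀ this.ne'
  linear_combination 2 * h1

theorem toeplitz_first {n : ℕ} {g : ℕ → ℝ} {x y : ℝ}
    (h : ∀ i ∈ Finset.range (n + 1), ∑ j ∈ Finset.range (n + 1),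
        g j * (2 / Real.pi * kernelCoeff (i - j))
      = ((if i = 0 then x else 0) + if i = n then y else 0) / 2) :
    y + (2 * n + 1) * x = 4 / Real.pi * ((n + 1) * Real.Wallis.W n) * g 0 := by
  have h' := toeplitz_last (n := n) (g := fun j => g (n - j)) (x := y) (y := x) (fun i hi => by
    have hi' : i ≤ n := by have := Finset.mem_range.mp hi; omega
    have h1 := h (n - i) (Finset.mem_range.mpr (by omega))
    have h2 := sum_reverse_eq n (fun j => g j * (2 / Real.pi)) i
    simp only [← mul_assoc] at h1 ⊢
    rw [h2, show (n : ℤ) - i = (n - i : ℕ) by push_cast [hi']; ring, h1, add_comm]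
    congr 2
    · exact if_congr (by omega) rfl rfl
    · exact if_congr (by omega) rfl rfl)
  simpa using h'

/-! ### From the local relations to harmonicity. -/

/-- The local relations satisfied by the correlations with a disorder at the face `(a, s)` and a
spin at its right, upper, left or lower vertex. The predicate `p` holds at the columns of the
domain. -/
structure IsSpinor (p : ℤ → Prop) (E N W S : ℤ → ℤ → ℝ) : Prop where
  abs_le : ∀ a s, |E a s| ≤ 1
  upRight_S : ∀ a s, Odd (a + s) → 0 ≤ s → p a → S (a + 1) (s + 1) = √2 * E a s - N a s
  upRight_W : ∀ a s, Odd (a + s) → 0 ≤ s → p a → W (a + 1) (s + 1) = √2 * N a s - E a s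
  upLeft_S : ∀ a s, Odd (a + s) → 0 ≤ s → p (a - 1) → S (a - 1) (s + 1) = N a s - √2 * W a s
  upLeft_E : ∀ a s, Odd (a + s) → 0 ≤ s → p (a - 1) → E (a - 1) (s + 1) = √2 * N a s - W a s

namespace IsSpinor

variable {p : ℤ → Prop} {E N W S : ℤ → ℤ → ℝ} (H : IsSpinor p E N W S)
include H

theorem sum_left {a s : ℤ} (ho : Odd (a + s)) (hs : 1 ≤ s) (hp : p (a - 1)) :
    E (a - 1) (s + 1) + E (a - 1) (s - 1) = √2 * (N a s + S a s) := by
  have h2 : √2 * √2 = (2 : ℝ) := Real.mul_self_sqrt (by norm_num)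
  have ho' : Odd (a - 1 + (s - 1)) := by obtain ⟨k, hk⟩ := ho; exact ⟨k - 1, by omega⟩
  have e1 := H.upLeft_E a s ho (by omega) hp
  have e2 := H.upRight_S (a - 1) (s - 1) ho' (by omega) hp
  have e3 := H.upRight_W (a - 1) (s - 1) ho' (by omega) hp
  simp only [sub_add_cancel] at e2 e3
  linear_combination e1 - √2 * e2 - e3 + (-E (a - 1) (s - 1)) * h2

theorem right_up {a s : ℤ} (ho : Odd (a + s)) (hs : 0 ≤ s) (hp : p a) (hp' : p (a + 1)) :
    E (a + 1) (s + 1) = 2 * E a s - √2 * N a s + W (a + 2) s := by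
  have h2 : √2 * √2 = (2 : ℝ) := Real.mul_self_sqrt (by norm_num)
  have ho' : Odd (a + 2 + s) := by obtain ⟨k, hk⟩ := ho; exact ⟨k + 1, by omega⟩
  have e1 := H.upLeft_E (a + 2) s ho' hs (by rwa [show a + 2 - 1 = a + 1 by ring])
  have e2 := H.upLeft_S (a + 2) s ho' hs (by rwa [show a + 2 - 1 = a + 1 by ring])
  have e3 := H.upRight_S a s ho hs hp
  rw [show a + 2 - 1 = a + 1 by ring] at e1 e2
  linear_combination e1 - √2 * e2 + √2 * e3 + (W (a + 2) s + E a s) * h2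

theorem up_eq {a s : ℤ} (ho : Odd (a + s)) (hs : 1 ≤ s) (hp : p a) :
    N (a + 1) (s - 1) = √2 * E a s - S a s := by
  have h2 : √2 * √2 = (2 : ℝ) := Real.mul_self_sqrt (by norm_num)
  have ho' : Odd (a + 1 + (s - 1)) := by obtain ⟨k, hk⟩ := ho; exact ⟨k, by omega⟩
  have e1 := H.upLeft_E (a + 1) (s - 1) ho' (by omega) (by rwa [add_sub_cancel_right])
  have e2 := H.upLeft_S (a + 1) (s - 1) ho' (by omega) (by rwa [add_sub_cancel_right])
  simp only [add_sub_cancel_right, sub_add_cancel] at e1 e2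
  linear_combination -√2 * e1 + e2 - N (a + 1) (s - 1) * h2

theorem right_down {a s : ℤ} (ho : Odd (a + s)) (hs : 1 ≤ s) (hp : p a) (hp' : p (a + 1)) :
    E (a + 1) (s - 1) = 2 * E a s - √2 * S a s - W (a + 2) s := by
  have h2 : √2 * √2 = (2 : ℝ) := Real.mul_self_sqrt (by norm_num)
  have ho' : Odd (a + 1 + (s - 1)) := by obtain ⟨k, hk⟩ := ho; exact ⟨k, by omega⟩
  have e1 := H.upRight_W (a + 1) (s - 1) ho' (by omega) hp'
  rw [show a + 1 + 1 = a + 2 by ring, sub_add_cancel, H.up_eq ho hs hp] at e1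
  linear_combination e1 + E a s * h2

/-- In the sum of `sum_left`, `right_up` and `right_down` the terms in `N`, `S` and `W (a + 2) s`
cancel. -/
theorem harmonic {a s : ℤ} (ho : Odd (a + s)) (hs : 1 ≤ s) (hp : p (a - 1)) (hp' : p a)
    (hp'' : p (a + 1)) : 4 * E a s
      = E (a + 1) (s + 1) + E (a - 1) (s + 1) + E (a + 1) (s - 1) + E (a - 1) (s - 1) := by
  linear_combination -(H.sum_left ho hs hp) - H.right_up ho (by omega) hp' hp''
    - H.right_down ho hs hp' hp''

/-- On the axis only the two upper neighbours are available; the remainder consists of left-vertex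
values, which reflection symmetry controls. -/
theorem axis_defect {a : ℤ} (ho : Odd a) (hp : p (a - 1)) (hp' : p a) (hp'' : p (a + 1)) :
    E a 0 - (E (a + 1) 1 + E (a - 1) 1) / 2 = (W a 0 - W (a + 2) 0) / 2 := by
  have ho' : Odd (a + 0) := by rwa [add_zero]
  have e1 := H.right_up ho' le_rfl hp' hp''
  have e2 := H.upLeft_E a 0 ho' le_rfl hp
  simp only [zero_add] at e1 e2
  linear_combination (-1 / 2 : ℝ) * e1 - (1 / 2 : ℝ) * e2

/-- Two steps up along a column whose right neighbour carries `+` boundary conditions. -/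
theorem column_up {a s : ℤ} (ho : Odd (a + s)) (hs : 0 ≤ s) (hp : p a)
    (hNS : N (a + 1) (s + 1) = S (a + 1) (s + 1)) :
    E a (s + 2) = 3 * E a s - 2 * √2 * N a s := by
  have h2 : √2 * √2 = (2 : ℝ) := Real.mul_self_sqrt (by norm_num)
  have ho' : Odd (a + 1 + (s + 1)) := by obtain ⟨k, hk⟩ := ho; exact ⟨k + 1, by omega⟩
  have e1 := H.upLeft_E (a + 1) (s + 1) ho' (by omega) (by rwa [add_sub_cancel_right])
  have e2 := H.upRight_S a s ho hs hp
  have e3 := H.upRight_W a s ho hs hp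
  rw [add_sub_cancel_right, add_assoc, one_add_one_eq_two, hNS] at e1
  linear_combination e1 + √2 * e2 - e3 + E a s * h2

theorem column_down {a s : ℤ} (ho : Odd (a + s)) (hs : 2 ≤ s) (hp : p a)
    (hNS : N (a + 1) (s - 1) = S (a + 1) (s - 1)) :
    E a (s - 2) = 3 * E a s - 2 * √2 * S a s := by
  have h2 : √2 * √2 = (2 : ℝ) := Real.mul_self_sqrt (by norm_num)
  have ho' : Odd (a + (s - 2)) := by obtain ⟨k, hk⟩ := ho; exact ⟨k - 1, by omega⟩
  have hu := H.up_eq ho (by omega) hp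
  have ho'' : Odd (a + 1 + (s - 1)) := by obtain ⟨k, hk⟩ := ho; exact ⟨k, by omega⟩
  have e1 := H.upLeft_E (a + 1) (s - 1) ho'' (by omega) (by rwa [add_sub_cancel_right])
  have e2 := H.upRight_S a (s - 2) ho' (by omega) hp
  have e3 := H.upRight_W a (s - 2) ho' (by omega) hp
  rw [show s - 2 + 1 = s - 1 by ring] at e2 e3
  rw [add_sub_cancel_right, sub_add_cancel] at e1
  linear_combination -√2 * e2 - e3 - E a (s - 2) * h2 - √2 * hNS + e1 + 2 * √2 * hu
    + 2 * E a s * h2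

end IsSpinor

/-! ### Infinite-volume limits of the observables. -/

/-- Mixed correlations are only known to be bounded, so limits are taken along an ultrafilter;
linear relations pass to them. -/
theorem exists_limit_obs (w : ℕ → ℤ) (c d : ℤ) : ∃ Y : ℤ → ℤ → Site → ℝ, ∀ a s x,
    Tendsto (fun L : ℕ => obs L (w L) c d a s x) (hyperfilter ℕ) (𝓝 (Y a s x)) ∧ |Y a s x| ≤ 1 := by
  have h : ∀ a s x, ∃ y, Tendsto (fun L : ℕ => obs L (w L) c d a s x) (hyperfilter ℕ) (𝓝 y) ∧
      |y| ≤ 1 := by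
    intro a s x
    have hK : IsCompact (Set.Icc (-1 : ℝ) 1) := isCompact_Icc
    obtain ⟨y, hy, hlim⟩ := hK.ultrafilter_le_nhds
      ((hyperfilter ℕ).map fun L : ℕ => obs L (w L) c d a s x)
      (by
        rw [Ultrafilter.coe_map, Filter.le_principal_iff, Filter.mem_map]
        exact Filter.univ_mem' fun L => abs_le.mp (abs_obs_le_one _ _ _ _ _ _ _))
    exact ⟨y, hlim, abs_le.mpr hy⟩
  choose Y hY using h
  exact ⟨Y, hY⟩

theorem isSpinor_of_tendsto {w : ℕ → ℤ} {c d : ℤ} {Y : ℤ → ℤ → Site → ℝ}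
    (hY : ∀ a s x, Tendsto (fun L : ℕ => obs L (w L) c d a s x) (hyperfilter ℕ) (𝓝 (Y a s x)) ∧
      |Y a s x| ≤ 1) (p : ℤ → Prop) (hp : ∀ a, p a → ∀ᶠ L in atTop, a < w L)
    (hd : ∀ᶠ L in atTop, 2 * d ≤ w L) :
    IsSpinor p (fun a s => Y a s (site (a + 1) s)) (fun a s => Y a s (site a (s + 1)))
      (fun a s => Y a s (site (a - 1) s)) (fun a s => Y a s (site a (s - 1))) := by
  have hev : ∀ q : ℕ → Prop, (∀ᶠ L in atTop, q L) → ∀ᶠ L in (hyperfilter ℕ : Filter ℕ), q L :=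
    fun q hq => hq.filter_mono Nat.hyperfilter_le_atTop
  have hbig : ∀ a s : ℤ, ∀ᶠ L : ℕ in atTop, -2 * (L : ℤ) + 2 ≤ a - s ∧ a + s ≤ 2 * L - 2 := by
    intro a s
    filter_upwards [eventually_ge_atTop (a.natAbs + s.natAbs + 2)] with L hL
    omega
  refine ⟨fun a s => (hY _ _ _).2, fun a s ho hs ha => ?_, fun a s ho hs ha => ?_,
    fun a s ho hs ha => ?_, fun a s ho hs ha => ?_⟩
  · refine tendsto_nhds_unique (hY _ _ _).1 ((((hY a s _).1.const_mul √2).sub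
      (hY a s _).1).congr' ?_)
    filter_upwards [hev _ (hbig a s), hev _ (hp a ha)] with L h1 h2
    rw [add_sub_cancel_right, obs_upRight_right ho hs h2 h1.1 h1.2]
  · refine tendsto_nhds_unique (hY _ _ _).1 ((((hY a s _).1.const_mul √2).sub
      (hY a s _).1).congr' ?_)
    filter_upwards [hev _ (hbig a s), hev _ (hp a ha)] with L h1 h2
    rw [add_sub_cancel_right, obs_upRight_up ho hs h2 h1.1 h1.2]
  · refine tendsto_nhds_unique (hY _ _ _).1 (((hY a s _).1.sub
      ((hY a s _).1.const_mul √2)).congr' ?_)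
    filter_upwards [hev _ (hbig a s), hev _ (hp _ ha), hev _ hd] with L h1 h2 h3
    rw [add_sub_cancel_right, obs_upLeft_left ho hs (by omega) h3 h1.1 h1.2]
  · refine tendsto_nhds_unique (hY _ _ _).1 ((((hY a s _).1.const_mul √2).sub
      (hY a s _).1).congr' ?_)
    filter_upwards [hev _ (hbig a s), hev _ (hp _ ha), hev _ hd] with L h1 h2 h3
    rw [sub_add_cancel, obs_upLeft_up ho hs (by omega) h3 h1.1 h1.2]

theorem eq_sum_of_support {f : ℤ → ℝ} {b : ℤ} {n : ℕ}
    (h : ∀ a, (∀ k < n, a ≠ b + 2 * (k : ℕ)) → f a = 0) (a : ℤ) :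
    f a = ∑ j ∈ Finset.range n, f (b + 2 * j) * if a - b - 2 * j = 0 then 1 else 0 := by
  by_cases hk : ∃ k < n, a = b + 2 * (k : ℕ)
  · obtain ⟨k, hk, rfl⟩ := hk
    rw [Finset.sum_eq_single k]
    · simp
    · intro j _ hj
      rw [if_neg (by omega), mul_zero]
    · intro hk'
      exact absurd (Finset.mem_range.mpr hk) hk'
  · push Not at hk
    rw [h a hk, Finset.sum_eq_zero]
    intro j hj
    rw [if_neg, mul_zero]
    have := hk j (Finset.mem_range.mp hj)
    omega

theorem tendsto_hyperfilter {f : ℕ → ℝ} {x : ℝ} (h : Tendsto f atTop (𝓝 x)) :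
    Tendsto f (hyperfilter ℕ) (𝓝 x) := h.mono_left Nat.hyperfilter_le_atTop

theorem mem_dom_large (x : Site) {L : ℕ} (hL : x.1.1.natAbs + x.1.2.natAbs ≤ L) :
    x ∈ dom L (2 * L + 1) := by
  rw [mem_dom]
  omega

/-- The cut `a < 2 * L + 1` removes nothing from the box. These boxes, and their translates, exhaust
the plane, so the limit does not depend on the position `i`. -/
theorem tendsto_diag (i : ℤ) (n : ℕ) : Tendsto (fun L : ℕ => plusExp θcrit (dom L (2 * L + 1))
    fun σ => σ (axisSite i) * σ (axisSite (i + n))) atTop (𝓝 (D n)) := by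
  set Λ : ℕ → Finset Site := fun L =>
    (dom L (2 * L + 1)).map (translate (i + n)).symm.toEmbedding with hΛ
  have hmem : ∀ (L : ℕ) x, translate (i + n) x ∈ dom L (2 * L + 1) ↔ x ∈ Λ L := by
    intro L x
    simp only [hΛ, Finset.mem_map_equiv, Equiv.symm_symm]
  have h1 : ∀ L : ℕ, plusExp θcrit (dom L (2 * L + 1))
      (fun σ => σ (axisSite i) * σ (axisSite (i + n))) = diagCorrIn n (Λ L) := by
    intro L
    have key := fun f => twistedSum_map (Λ := Λ L) (Λ' := dom L (2 * L + 1))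
      (translate (i + n)) (fun x => hmem L x) (translate_adj _) (translate_symm_adj _) 1 f
    rw [plusExp_eq_twistedSum, ← key, ← key, diagCorrIn, plusExp_eq_twistedSum]
    simp only [Function.comp_apply, translate_symm_axisSite, sub_self]
    rw [show i - (i + n) = -(n : ℤ) by ring]
    rfl
  simp only [h1]
  refine (tendsto_diagCorrIn n).comp (tendsto_atTop_finset_of_monotone ?_ ?_)
  · intro L L' hLL x hx
    rw [← hmem, mem_dom] at hx ⊢
    omega
  · intro x
    refine ⟨_, (hmem _ x).mp (mem_dom_large _ le_rfl)⟩

theorem tendsto_mag (m : ℕ) : Tendsto (fun L : ℕ => plusExp θcrit (dom L 0)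
    fun σ => σ (axisSite (-m)) * σ (axisSite 0)) atTop (𝓝 (M m)) := by
  set Λ : ℕ → Finset InnerSite := fun L => (dom L 0).subtype fun x => x.1.1 < 0 with hΛ
  have h1 : ∀ L : ℕ, plusExp θcrit (dom L 0)
      (fun σ => σ (axisSite (-m)) * σ (axisSite 0)) = magIn m (Λ L) := by
    intro L
    rw [magIn_eq]
    simp only [hΛ]
    rw [Finset.subtype_map, Finset.filter_true_of_mem]
    intro x hx
    exact (mem_dom.mp hx).2.2
  simp only [h1]
  refine (tendsto_magIn m).comp (tendsto_atTop_finset_of_monotone ?_ ?_)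
  · intro L L' hLL x hx
    simp only [hΛ, Finset.mem_subtype, mem_dom] at hx ⊢
    omega
  · rintro ⟨x, hx⟩
    refine ⟨x.1.1.natAbs + x.1.2.natAbs, ?_⟩
    simp only [hΛ, Finset.mem_subtype, mem_dom]
    omega

theorem plusExp_mul_self (Λ : Finset Site) (x : Site) :
    plusExp θcrit Λ (fun σ => σ x * σ x) = 1 := by
  have h : ∀ τ : Λ → ℤˣ, plusSpin Λ τ x * plusSpin Λ τ x = 1 := fun τ => by
    rcases plusSpin_eq_one_or Λ τ x with h | h <;> simp [h]
  rw [plusExp_eq_twistedSum]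
  have : twistedSum Λ 1 (fun σ => σ x * σ x) = twistedSum Λ 1 1 := by
    simp only [twistedSum, h, Pi.one_apply]
  rw [this, div_self (twistedSum_one_pos _ _).ne']

theorem D_zero : D 0 = 1 := by
  refine tendsto_nhds_unique (tendsto_diag 0 0) ?_
  simp [plusExp_mul_self]

theorem M_zero : M 0 = 1 := by
  refine tendsto_nhds_unique (tendsto_mag 0) ?_
  simp [plusExp_mul_self]

/-- Coinciding spins square to `1` and leave the correlation of two disorders. The sign is the
spinor branching: the face `2 * n + 1` is to the left of one spin site and to the right of the
other. -/
theorem obs_swap_spins (L w c : ℤ) (n : ℕ) : obs L w c (n + 1 : ℕ) (2 * n + 1) 0 (axisSite (n + 1 : ℕ))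
    = -obs L w c n (2 * n + 1) 0 (axisSite n) := by
  have h : ∀ (x : Site) (ε : Sym2 Site → ℝ), twistedSum (dom L w) ε (fun σ => σ x * σ x)
      = twistedSum (dom L w) ε 1 := by
    intro x ε
    have h : ∀ τ : dom L w → ℤˣ, plusSpin (dom L w) τ x * plusSpin (dom L w) τ x = 1 := fun τ => by
      rcases plusSpin_eq_one_or (dom L w) τ x with h | h <;> simp [h]
    simp only [twistedSum, h, Pi.one_apply]
  unfold obs
  rw [h, h, if_neg (by push_cast; omega), if_pos (by omega)]
  ring

/-! ### The full plane: recursion for the diagonal correlations. -/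

section FullPlane

variable {n : ℕ} {Y : ℤ → ℤ → Site → ℝ}

/-- The linear relations between the diagonal correlations of spins and of disorders. -/
theorem diag_relations (hY : ∀ a s x, Tendsto (fun L : ℕ => obs L (2 * L + 1) (-1) n a s x)
      (hyperfilter ℕ) (𝓝 (Y a s x)) ∧ |Y a s x| ≤ 1) :
    D (n + 1) + (2 * n + 1) * (-Y (2 * n + 1) 0 (axisSite n))
      = 4 / Real.pi * ((n + 1) * Real.Wallis.W n) * Y (2 * n - 1) 0 (axisSite n) ∧
    -Y (2 * n + 1) 0 (axisSite n) + (2 * n + 1) * D (n + 1)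
      = 4 / Real.pi * ((n + 1) * Real.Wallis.W n) * D n := by
  have H := isSpinor_of_tendsto hY (fun _ => True)
    (fun a _ => by filter_upwards [eventually_ge_atTop a.natAbs] with L hL; omega)
    (by filter_upwards [eventually_ge_atTop n] with L hL; omega)
  set E : ℤ → ℤ → ℝ := fun a s => Y a s (site (a + 1) s) with hE
  set W : ℤ → ℤ → ℝ := fun a s => Y a s (site (a - 1) s) with hW
  have hzero : ∀ {a s x}, (∀ᶠ L : ℕ in atTop, obs L (2 * L + 1) (-1) n a s x = 0) → Y a s x = 0 :=
    fun h => tendsto_nhds_unique (hY _ _ _).1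
      (tendsto_const_nhds.congr' ((h.filter_mono Nat.hyperfilter_le_atTop).mono fun _ h => h.symm))
  have hodd : Odd (-1 : ℤ) := ⟨-1, by norm_num⟩
  have hlt : ∀ a : ℤ, Odd a → a < -1 → E a 0 = 0 := fun a ha h => hzero <| by
    filter_upwards [eventually_ge_atTop (a.natAbs + n)] with L hL
    exact obs_right_eq_zero_of_lt ha hodd (by omega) h (by omega) (by omega) (by omega)
  have hgt : ∀ a : ℤ, Odd a → 2 * (n : ℤ) < a → E a 0 = 0 := fun a ha h => hzero <| by
    filter_upwards [eventually_ge_atTop (a.natAbs + n + 1)] with L hL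
    exact obs_right_eq_zero_of_gt ha hodd (by omega) (by omega) h (by omega) (by omega)
  have hmid : ∀ a : ℤ, Odd a → -1 < a → a < 2 * (n : ℤ) → W a 0 = 0 := fun a ha h h' => hzero <| by
    filter_upwards [eventually_ge_atTop (a.natAbs + n + 1)] with L hL
    exact obs_left_eq_zero ha hodd (by omega) (by omega) h' (by omega) (by omega)
  have hDn : E (-1) 0 = D n := by
    refine tendsto_nhds_unique (hY _ _ _).1 ((tendsto_hyperfilter (tendsto_diag 0 n)).congr ?_)
    intro L
    rw [obs_self (by omega), neg_add_cancel, zero_add]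
    have := site_axis 0
    rw [mul_zero] at this
    rw [this]
  have hDn1 : W (-1) 0 = D (n + 1) := by
    refine tendsto_nhds_unique (hY _ _ _).1
      ((tendsto_hyperfilter (tendsto_diag (-1) (n + 1))).congr ?_)
    intro L
    rw [obs_self (by omega), show (-1 : ℤ) - 1 = 2 * (-1) by norm_num, site_axis]
    push_cast
    rw [show (-1 : ℤ) + (n + 1) = n by ring]
  -- Faces have `a + s` odd. Diagonal steps preserve this parity, so extension by zero stays
  -- harmonic.
  set h : ℤ → ℕ → ℝ := fun a s => if Odd (a + s) then E a s else 0 with hh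
  have hb : ∀ a s, |h a s| ≤ 1 := by
    intro a s
    simp only [hh]
    split_ifs
    · exact H.abs_le _ _
    · simp
  have harm : ∀ a s, 4 * h a (s + 1) = h (a + 1) (s + 2) + h (a - 1) (s + 2) + h (a + 1) s
      + h (a - 1) s := by
    intro a s
    have p1 : Odd (a + 1 + (s + 2 : ℕ)) ↔ Odd (a + (s + 1 : ℕ)) := by
      simp only [Int.odd_iff]; push_cast; omega
    have p2 : Odd (a - 1 + (s + 2 : ℕ)) ↔ Odd (a + (s + 1 : ℕ)) := by
      simp only [Int.odd_iff]; push_cast; omega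
    have p3 : Odd (a + 1 + (s : ℕ)) ↔ Odd (a + (s + 1 : ℕ)) := by
      simp only [Int.odd_iff]; push_cast; omega
    have p4 : Odd (a - 1 + (s : ℕ)) ↔ Odd (a + (s + 1 : ℕ)) := by
      simp only [Int.odd_iff]; push_cast; omega
    simp only [hh, p1, p2, p3, p4]
    split_ifs with ho
    · have := H.harmonic ho (by push_cast; omega) trivial trivial trivial
      push_cast at this ⊢
      rwa [add_assoc (s : ℤ), one_add_one_eq_two, add_sub_cancel_right] at this
    · simp
  have h0 := eq_sum_of_support (f := fun a => h a 0) (b := -1) (n := n + 1) (by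
    intro a ha
    simp only [hh]
    split_ifs with ho
    · rw [Nat.cast_zero, add_zero] at ho
      by_cases h1 : a < -1
      · exact hlt a ho h1
      · by_cases h2 : 2 * (n : ℤ) < a
        · exact hgt a ho h2
        · exfalso
          obtain ⟨k, hk⟩ := ho
          exact ha (k + 1).toNat (by omega) (by omega)
    · rfl)
  have hg : ∀ j : ℕ, h (-1 + 2 * j) 0 = E (-1 + 2 * j) 0 := by
    intro j
    simp only [hh]
    rw [if_pos]
    · simp
    · exact ⟨j - 1, by push_cast; ring⟩
  have hdef := defect_eq_sum hb harm (-1) (n + 1) _ h0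
  -- The normal derivative at the face `2 * i - 1` is half of `W (2 * i - 1) 0 - W (2 * i + 1) 0`;
  -- by `hmid` only the leftmost and rightmost values survive.
  have key : ∀ i ∈ Finset.range (n + 1), ∑ j ∈ Finset.range (n + 1),
      h (-1 + 2 * j) 0 * (2 / Real.pi * kernelCoeff (i - j))
      = ((if i = 0 then D (n + 1) else 0) + if i = n then -W (2 * n + 1) 0 else 0) / 2 := by
    intro i hi
    have hi' : i ≤ n := by have := Finset.mem_range.mp hi; omega
    rw [← hdef]
    have ho : Odd (-1 + 2 * (i : ℤ)) := ⟨i - 1, by ring⟩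
    have e1 := H.axis_defect ho trivial trivial trivial
    have e2 : h (-1 + 2 * i + 1) 1 = E (-1 + 2 * i + 1) 1 := by
      simp only [hh]
      rw [if_pos, Nat.cast_one]
      exact ⟨i, by push_cast; ring⟩
    have e3 : h (-1 + 2 * i - 1) 1 = E (-1 + 2 * i - 1) 1 := by
      simp only [hh]
      rw [if_pos, Nat.cast_one]
      exact ⟨i - 1, by push_cast; ring⟩
    rw [hg, e2, e3]
    refine e1.trans ?_
    have w1 : W (-1 + 2 * i) 0 = if i = 0 then D (n + 1) else 0 := by
      split_ifs with h1
      · rw [h1, ← hDn1]; simp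
      · exact hmid _ ho (by omega) (by omega)
    have w2 : W (-1 + 2 * i + 2) 0 = if i = n then W (2 * n + 1) 0 else 0 := by
      split_ifs with h1
      · rw [h1]; congr 1; ring
      · refine hmid _ ?_ (by omega) (by omega)
        exact ⟨i, by ring⟩
    change (W (-1 + 2 * i) 0 - W (-1 + 2 * i + 2) 0) / 2 = _
    rw [w1, w2]
    congr 1
    split_ifs <;> ring
  have hW1 : W (2 * n + 1) 0 = Y (2 * n + 1) 0 (axisSite n) := by
    simp only [hW]
    rw [add_sub_cancel_right, site_axis]
  have hEn : h (-1 + 2 * n) 0 = Y (2 * n - 1) 0 (axisSite n) := by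
    rw [hg]
    simp only [hE]
    rw [show -1 + 2 * (n : ℤ) + 1 = 2 * n by ring, site_axis,
      show -1 + 2 * (n : ℤ) = 2 * n - 1 by ring]
  have hE0 : h (-1 + 2 * (0 : ℕ)) 0 = D n := by
    rw [hg, ← hDn]; simp
  have r1 := toeplitz_last key
  have r2 := toeplitz_first key
  rw [hW1] at r1 r2
  rw [hEn] at r1
  rw [hE0] at r2
  exact ⟨r1, r2⟩

end FullPlane

/-- The disorders have diagonal correlations that satisfy the same recursion as those of the
spins. -/
theorem exists_dual_correlations : ∃ Ds : ℕ → ℝ, Ds 0 = D 0 ∧ (∀ n, |Ds n| ≤ 1) ∧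
    ∀ n : ℕ, D (n + 1) + (2 * n + 1) * Ds (n + 1)
        = 4 / Real.pi * ((n + 1) * Real.Wallis.W n) * Ds n ∧
      Ds (n + 1) + (2 * n + 1) * D (n + 1)
        = 4 / Real.pi * ((n + 1) * Real.Wallis.W n) * D n := by
  choose Y hY using fun n : ℕ => exists_limit_obs (fun L => 2 * L + 1) (-1) n
  have hs : ∀ n : ℕ, Y (n + 1) (2 * n + 1) 0 (axisSite (n + 1 : ℕ))
      = -Y n (2 * n + 1) 0 (axisSite n) := by
    intro n
    refine tendsto_nhds_unique (hY (n + 1) _ _ _).1 ((hY n _ _ _).1.neg.congr fun L => ?_)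
    rw [obs_swap_spins]
  -- Both spins are at `(2 * n, 0)` and cancel, leaving disorders at the faces `-1` and `2 * n - 1`.
  refine ⟨fun n => Y n (2 * n - 1) 0 (axisSite n), ?_, fun n => (hY n _ _ _).2, fun n => ?_⟩
  · refine tendsto_nhds_unique (hY 0 _ _ _).1 ((tendsto_hyperfilter (tendsto_diag 0 0)).congr ?_)
    intro L
    simp only [Nat.cast_zero, mul_zero, zero_sub, add_zero]
    rw [obs_self (by omega)]
  · have := diag_relations (hY n)
    simp only
    rw [show 2 * ((n + 1 : ℕ) : ℤ) - 1 = 2 * n + 1 by push_cast; ring, hs]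
    exact this

theorem abs_D_le_one (n : ℕ) : |D n| ≤ 1 := by
  refine le_of_tendsto (tendsto_diag 0 n).abs (Eventually.of_forall fun L => ?_)
  rw [plusExp_eq_twistedSum, abs_div, abs_of_pos (twistedSum_one_pos _ _)]
  exact div_le_one_of_le₀ (abs_twistedSum_le _ _ (fun _ => Or.inl rfl) _ _)
    (twistedSum_one_pos _ _).le

/-- The difference `δ` of spin and disorder correlations satisfies `2 * k * δ (k + 1) = c * δ k`
with `c ≥ 2 * k + 1`, so it would grow at least like `√k` if `δ 1 ≠ 0`, contradicting boundedness.
With `δ = 0` the two recursions become one. -/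
theorem D_succ (n : ℕ) : D (n + 1) = 2 / Real.pi * Real.Wallis.W n * D n := by
  obtain ⟨Ds, h0, hb, hrec⟩ := exists_dual_correlations
  set δ : ℕ → ℝ := fun k => D k - Ds k with hδ
  have hδrec : ∀ k : ℕ, 2 * k * δ (k + 1) = 4 / Real.pi * ((k + 1) * Real.Wallis.W k) * δ k := by
    intro k
    have := hrec k
    simp only [hδ]
    linear_combination this.2 - this.1
  have hpi := Real.pi_pos
  -- The start is `δ 1`, since the relation at `k = 0` has left coefficient zero. The growth rate
  -- comes from `(2k + 3)^2 ≥ 4 (k + 1) (k + 2)`.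
  have hgrow : ∀ k : ℕ, (k + 1) * δ 1 ^ 2 ≤ δ (k + 1) ^ 2 := by
    intro k
    induction k with
    | zero => simp
    | succ k ih =>
      have h1 := hδrec (k + 1)
      have h2 := Real.Wallis.le_W (k + 1)
      set c : ℝ := 4 / Real.pi * (((k + 1 : ℕ) + 1) * Real.Wallis.W (k + 1)) with hc
      have h3 : 2 * (k : ℝ) + 3 ≤ c := by
        rw [hc]
        push_cast at h2 ⊢
        have h4 : 2 * (k : ℝ) + 3 = 4 / Real.pi * ((k + 1 + 1) *
            ((2 * (k + 1) + 1) / (2 * (k + 1) + 2) * (Real.pi / 2))) := by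
          field_simp
          ring
        rw [h4]
        gcongr
      have h5 : (2 * (k + 1 : ℝ) * δ (k + 1 + 1)) ^ 2 = c ^ 2 * δ (k + 1) ^ 2 := by
        push_cast at h1
        rw [h1]; ring
      have h6 : (2 * (k : ℝ) + 3) ^ 2 * ((k + 1) * δ 1 ^ 2) ≤ c ^ 2 * δ (k + 1) ^ 2 := by
        gcongr
      rw [← h5] at h6
      have h7 : 4 * ((k : ℝ) + 1) ^ 2 * ((k + 2) * δ 1 ^ 2)
          ≤ (2 * (k : ℝ) + 3) ^ 2 * ((k + 1) * δ 1 ^ 2) := by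
        rw [← mul_assoc, ← mul_assoc]
        refine mul_le_mul_of_nonneg_right ?_ (sq_nonneg _)
        have hk : (0 : ℝ) ≤ k := k.cast_nonneg
        nlinarith
      have h8 : 4 * ((k : ℝ) + 1) ^ 2 * ((k + 2) * δ 1 ^ 2)
          ≤ 4 * ((k : ℝ) + 1) ^ 2 * δ (k + 1 + 1) ^ 2 := by
        refine (h7.trans h6).trans_eq (by ring)
      have h9 := le_of_mul_le_mul_left h8 (by positivity)
      push_cast
      linarith
  have hδ1 : δ 1 = 0 := by
    by_contra hne
    have hpos : 0 < δ 1 ^ 2 := by positivity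
    obtain ⟨k, hk⟩ := exists_nat_gt (4 / δ 1 ^ 2)
    rw [div_lt_iff₀ hpos] at hk
    have h1 := hgrow k
    have h2 := abs_le.mp (abs_D_le_one (k + 1))
    have h3 := abs_le.mp (hb (k + 1))
    have h4 : δ (k + 1) ^ 2 ≤ 4 := by
      have : |δ (k + 1)| ≤ 2 := by
        rw [abs_le]; simp only [hδ]; constructor <;> linarith [h2.1, h2.2, h3.1, h3.2]
      have := abs_le.mp this
      nlinarith [this.1, this.2]
    nlinarith
  have hδ0 : ∀ k, δ (k + 1) = 0 := by
    intro k
    induction k with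
    | zero => exact hδ1
    | succ k ih =>
      have := hδrec (k + 1)
      rw [ih, mul_zero] at this
      have hk : (2 * ((k + 1 : ℕ) : ℝ)) ≠ 0 := by positivity
      exact (mul_eq_zero.mp this).resolve_left hk
  have h1 := (hrec n).2
  have h2 := hδ0 n
  simp only [hδ] at h2
  have h3 : (2 * (n : ℝ) + 2) ≠ 0 := by positivity
  apply mul_left_cancel₀ h3
  linear_combination h1 + h2

/-! ### The half-plane with `+` boundary column: even extension and recursion. -/

/-- Applied to the upper and lower vertices of a face in column `0`, this is the boundary condition
`N = S`. -/
theorem obs_congr_of_notMem {L w c d a s : ℤ} {x y : Site} (hx : x ∉ dom L w) (hy : y ∉ dom L w) :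
    obs L w c d a s x = obs L w c d a s y := by
  simp only [obs, twistedSum, plusSpin_of_notMem _ hx, plusSpin_of_notMem _ hy]

/-- The even extension, to the plane, of a function on the left half-plane, supported by the odd
sublattice. -/
noncomputable def evenExtension (E : ℤ → ℤ → ℝ) (a : ℤ) (s : ℕ) : ℝ :=
  if Odd (a + s) then
    -- Evenness and harmonicity on the column `a = 0` force this average.
    if a = 0 then (E (-1) (s + 1) + E (-1) (s - 1)) / 2 else E (-|a|) s
  else 0

theorem evenExtension_neg (E : ℤ → ℤ → ℝ) (a : ℤ) (s : ℕ) :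
    evenExtension E (-a) s = evenExtension E a s := by
  have h : Odd (-a + s) ↔ Odd (a + s) := by simp only [Int.odd_iff]; omega
  simp only [evenExtension, h, abs_neg, neg_eq_zero]

theorem evenExtension_of_neg (E : ℤ → ℤ → ℝ) {a : ℤ} (ha : a < 0) {s : ℕ} (ho : Odd (a + s)) :
    evenExtension E a s = E a s := by
  rw [evenExtension, if_pos ho, if_neg ha.ne, abs_of_neg ha, neg_neg]

theorem evenExtension_zero (E : ℤ → ℤ → ℝ) {s : ℕ} (ho : Odd (s : ℤ)) :
    evenExtension E 0 s = (E (-1) (s + 1) + E (-1) (s - 1)) / 2 := by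
  rw [evenExtension, if_pos (by rwa [zero_add]), if_pos rfl]

theorem evenExtension_of_not_odd (E : ℤ → ℤ → ℝ) {a : ℤ} {s : ℕ} (ho : ¬Odd (a + s)) :
    evenExtension E a s = 0 := if_neg ho

theorem abs_evenExtension_le {E : ℤ → ℤ → ℝ} (hE : ∀ a s, |E a s| ≤ 1) (a : ℤ) (s : ℕ) :
    |evenExtension E a s| ≤ 1 := by
  unfold evenExtension
  split_ifs
  · have h1 := abs_le.mp (hE (-1) (s + 1))
    have h2 := abs_le.mp (hE (-1) (s - 1))
    rw [abs_le]
    constructor <;> linarith [h1.1, h1.2, h2.1, h2.2]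
  · exact hE _ _
  · simp

namespace IsSpinor

variable {E N W S : ℤ → ℤ → ℝ} (H : IsSpinor (· < 0) E N W S)
  (hNS : ∀ s, Odd s → N 0 s = S 0 s)
include H hNS

/-- Column `0` is harmonic by definition and the columns left of `-1` by `harmonic`. At column `-1`
the boundary condition enters: `column_up` and `column_down` replace the missing relations on the
right. -/
theorem evenExtension_harmonic (a : ℤ) (s : ℕ) : 4 * evenExtension E a (s + 1)
    = evenExtension E (a + 1) (s + 2) + evenExtension E (a - 1) (s + 2)
      + evenExtension E (a + 1) s + evenExtension E (a - 1) s := by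
  wlog ha : a ≤ 0 generalizing a
  · have := this (-a) (by omega)
    rw [evenExtension_neg, show -a + 1 = -(a - 1) by ring, show -a - 1 = -(a + 1) by ring] at this
    simp only [evenExtension_neg] at this
    linarith
  by_cases ho : Odd (a + (s + 1 : ℕ))
  swap
  · rw [evenExtension_of_not_odd, evenExtension_of_not_odd, evenExtension_of_not_odd,
      evenExtension_of_not_odd, evenExtension_of_not_odd]
    · ring
    all_goals
      simp only [Int.not_odd_iff] at *
      push_cast at *
      omega
  have ho' : (a + (s + 1)) % 2 = 1 := by rw [Int.odd_iff] at ho; exact_mod_cast ho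
  rcases ha.lt_or_eq with ha | rfl
  · rw [evenExtension_of_neg E ha ho,
      evenExtension_of_neg E (show a - 1 < 0 by omega) (s := s + 2)
        (by rw [Int.odd_iff]; push_cast; omega),
      evenExtension_of_neg E (show a - 1 < 0 by omega) (s := s)
        (by rw [Int.odd_iff]; omega)]
    by_cases h1 : a = -1
    · subst h1
      rw [neg_add_cancel, evenExtension_zero E (by rw [Int.odd_iff]; push_cast; omega),
        evenExtension_zero E (by rw [Int.odd_iff]; omega)]
      have e1 := H.sum_left ho (by push_cast; omega) (by norm_num)
      have e2 := H.column_up ho (by positivity) (by norm_num)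
        (hNS _ (by rw [Int.odd_iff]; push_cast; omega))
      have e3 := H.column_down ho (by push_cast; omega) (by norm_num)
        (hNS _ (by rw [Int.odd_iff]; push_cast; omega))
      push_cast at e1 e2 e3 ⊢
      rw [show (s : ℤ) + 1 + 1 = s + 2 by ring, add_sub_cancel_right] at e1
      rw [show (s : ℤ) + 1 + 2 = s + 3 by ring] at e2
      rw [show (s : ℤ) + 1 - 2 = s - 1 by ring] at e3
      rw [show (s : ℤ) + 2 + 1 = s + 3 by ring, show (s : ℤ) + 2 - 1 = s + 1 by ring]
      linear_combination -e1 - e2 / 2 - e3 / 2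
    · rw [evenExtension_of_neg E (show a + 1 < 0 by omega) (s := s + 2)
          (by rw [Int.odd_iff]; push_cast; omega),
        evenExtension_of_neg E (show a + 1 < 0 by omega) (s := s)
          (by rw [Int.odd_iff]; omega)]
      have := H.harmonic ho (by push_cast; omega) (by omega) ha (by omega)
      push_cast at this ⊢
      rwa [add_assoc (s : ℤ), one_add_one_eq_two, add_sub_cancel_right] at this
  · rw [evenExtension_zero E (by rw [Int.odd_iff]; push_cast; omega), zero_add,
      show (0 : ℤ) - 1 = -1 by norm_num, ← evenExtension_neg E 1, ← evenExtension_neg E 1,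
      evenExtension_of_neg E (by norm_num) (s := s + 2) (by rw [Int.odd_iff]; push_cast; omega),
      evenExtension_of_neg E (by norm_num) (s := s) (by rw [Int.odd_iff]; omega)]
    push_cast
    rw [show (s : ℤ) + 1 + 1 = s + 2 by ring, add_sub_cancel_right]
    ring

theorem evenExtension_defect {a : ℤ} (ho : Odd a) (ha : a < 0) :
    evenExtension E a 0 - (evenExtension E (a + 1) 1 + evenExtension E (a - 1) 1) / 2
      = (W a 0 - if a = -1 then 0 else W (a + 2) 0) / 2 := by
  have ho' := Int.odd_iff.mp ho
  rw [evenExtension_of_neg E ha (s := 0) (by rw [Int.odd_iff]; push_cast; omega),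
    evenExtension_of_neg E (show a - 1 < 0 by omega) (s := 1)
      (by rw [Int.odd_iff]; push_cast; omega)]
  split_ifs with h1
  · subst h1
    rw [neg_add_cancel, evenExtension_zero E (by norm_num)]
    have e1 := H.upLeft_E (-1) 0 ⟨-1, by norm_num⟩ le_rfl (by norm_num)
    have e2 := H.column_up (a := -1) (s := 0) ⟨-1, by norm_num⟩ le_rfl (by norm_num)
      (hNS _ ⟨0, by norm_num⟩)
    norm_num at e1 e2 ⊢
    linear_combination -e1 / 2 - e2 / 4
  · rw [evenExtension_of_neg E (show a + 1 < 0 by omega) (s := 1)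
      (by rw [Int.odd_iff]; push_cast; omega)]
    exact_mod_cast H.axis_defect ho (by omega) ha (by omega)

end IsSpinor

theorem M_succ (m : ℕ) : M (m + 1) = 2 / Real.pi * Real.Wallis.W (2 * m + 1) * M m := by
  obtain ⟨c, hc⟩ : ∃ c : ℤ, c = -(2 * m) - 1 := ⟨_, rfl⟩
  -- The fixed spin is at the origin, on the `+` column, so coinciding disorders leave a
  -- magnetization.
  obtain ⟨Y, hY⟩ := exists_limit_obs (fun _ => 0) c 0
  have H := isSpinor_of_tendsto hY (· < 0) (fun a ha => Eventually.of_forall fun _ => ha)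
    (Eventually.of_forall fun _ => by norm_num)
  set E : ℤ → ℤ → ℝ := fun a s => Y a s (site (a + 1) s) with hE
  set W : ℤ → ℤ → ℝ := fun a s => Y a s (site (a - 1) s) with hW
  have hzero : ∀ {a s x}, (∀ᶠ L : ℕ in atTop, obs L 0 c 0 a s x = 0) → Y a s x = 0 :=
    fun h => tendsto_nhds_unique (hY _ _ _).1
      (tendsto_const_nhds.congr' ((h.filter_mono Nat.hyperfilter_le_atTop).mono fun _ h => h.symm))
  have hodd : Odd c := ⟨-m - 1, by omega⟩
  have hNS : ∀ s, Odd s → Y 0 s (site 0 (s + 1)) = Y 0 s (site 0 (s - 1)) := by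
    intro s hs
    rw [Int.odd_iff] at hs
    refine tendsto_nhds_unique (hY _ _ _).1 ((hY _ _ _).1.congr fun L => ?_)
    apply obs_congr_of_notMem <;> rw [mem_dom, site_fst (by rw [Int.even_iff]; omega)] <;> omega
  have hlt : ∀ a : ℤ, Odd a → a < c → E a 0 = 0 := fun a ha h => hzero <| by
    filter_upwards [eventually_ge_atTop a.natAbs] with L hL
    exact obs_right_eq_zero_of_lt ha hodd (by omega) h (by omega) (by omega) (by omega)
  have hmid : ∀ a : ℤ, Odd a → c < a → a < 0 → W a 0 = 0 := fun a ha h h' => hzero <| by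
    filter_upwards [eventually_ge_atTop c.natAbs] with L hL
    exact obs_left_eq_zero ha hodd (by omega) h (by omega) (by omega) (by omega)
  have hEc : E c 0 = M m := by
    refine tendsto_nhds_unique (hY _ _ _).1 ((tendsto_hyperfilter (tendsto_mag m)).congr ?_)
    intro L
    rw [obs_self (by omega), show c + 1 = 2 * (-m) by omega, site_axis]
  have hWc : W c 0 = M (m + 1) := by
    refine tendsto_nhds_unique (hY _ _ _).1 ((tendsto_hyperfilter (tendsto_mag (m + 1))).congr ?_)
    intro L
    rw [obs_self (by omega), show c - 1 = 2 * (-(m + 1 : ℕ)) by push_cast; omega, site_axis]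
  have hdefect : ∀ a : ℤ, Odd a → c ≤ a → a < 0 →
      evenExtension E a 0 - (evenExtension E (a + 1) 1 + evenExtension E (a - 1) 1) / 2
        = (if a = c then M (m + 1) else 0) / 2 := by
    intro a ha hca ha0
    have ha' := Int.odd_iff.mp ha
    rw [H.evenExtension_defect hNS ha ha0]
    have h1 : (if a = -1 then 0 else W (a + 2) 0) = 0 := by
      split_ifs
      · rfl
      · exact hmid _ (by rw [Int.odd_iff]; omega) (by omega) (by omega)
    rw [h1, sub_zero]
    congr 1
    split_ifs with h2
    · rw [h2, hWc]
    · exact hmid a ha (by omega) ha0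
  have hEext : ∀ a : ℤ, Odd a → a < c → evenExtension E a 0 = 0 := by
    intro a ha hac
    rw [evenExtension_of_neg E (by omega) (by rwa [Nat.cast_zero, add_zero])]
    exact hlt a ha hac
  have h0 := eq_sum_of_support (f := fun a => evenExtension E a 0) (b := c) (n := 2 * m + 1 + 1) (by
    intro a ha
    by_cases ho : Odd (a + (0 : ℕ))
    · rw [Nat.cast_zero, add_zero] at ho
      by_cases h1 : a < c
      · exact hEext a ho h1
      · by_cases h2 : -a < c
        · rw [← evenExtension_neg]
          exact hEext (-a) ho.neg h2
        · exfalso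
          rw [Int.odd_iff] at ho
          exact ha ((a - c) / 2).toNat (by omega) (by omega)
    · exact evenExtension_of_not_odd E ho)
  have hdef := defect_eq_sum (abs_evenExtension_le H.abs_le) (H.evenExtension_harmonic hNS) c
    (2 * m + 1 + 1) _ h0
  -- The interval runs from `c = -2m - 1` to `2m + 1`. Its right half follows from `hdefect` by
  -- evenness, so both ends carry `M (m + 1)`.
  have key : ∀ i ∈ Finset.range (2 * m + 1 + 1), ∑ j ∈ Finset.range (2 * m + 1 + 1),
      evenExtension E (c + 2 * j) 0 * (2 / Real.pi * kernelCoeff (i - j))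
      = ((if i = 0 then M (m + 1) else 0) + if i = 2 * m + 1 then M (m + 1) else 0) / 2 := by
    intro i hi
    have hi' : i < 2 * m + 1 + 1 := Finset.mem_range.mp hi
    rw [← hdef]
    have ho : Odd (c + 2 * (i : ℤ)) := hodd.add_even (even_two_mul _)
    by_cases him : i ≤ m
    · rw [hdefect _ ho (by omega) (by omega), if_neg (show i ≠ 2 * m + 1 by omega), add_zero]
      congr 1
      exact if_congr (by omega) rfl rfl
    · have h1 := hdefect _ ho.neg (by omega) (by omega)
      rw [show -(c + 2 * (i : ℤ)) + 1 = -(c + 2 * i - 1) by ring,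
        show -(c + 2 * (i : ℤ)) - 1 = -(c + 2 * i + 1) by ring, evenExtension_neg,
        evenExtension_neg, evenExtension_neg, add_comm (evenExtension E (c + 2 * i - 1) 1)] at h1
      rw [h1, if_neg (show i ≠ 0 by omega), zero_add]
      congr 1
      exact if_congr (by omega) rfl rfl
  have r := toeplitz_last key
  rw [← evenExtension_neg, show -(c + 2 * ((2 * m + 1 : ℕ) : ℤ)) = c by push_cast; omega,
    evenExtension_of_neg E (by omega) (by rwa [Nat.cast_zero, add_zero]), Nat.cast_zero, hEc] at r
  have h3 : (4 * (m : ℝ) + 4) ≠ 0 := by positivity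
  apply mul_left_cancel₀ h3
  push_cast at r
  linear_combination r

/-! ### Non-vanishing and the product formula. -/

theorem D_ne_zero (n : ℕ) : D n ≠ 0 := by
  induction n with
  | zero => simp [D_zero]
  | succ n ih =>
    rw [D_succ]
    exact mul_ne_zero (mul_ne_zero (div_ne_zero two_ne_zero Real.pi_ne_zero)
      (Real.Wallis.W_pos n).ne') ih

theorem M_ne_zero (m : ℕ) : M m ≠ 0 := by
  induction m with
  | zero => simp [M_zero]
  | succ m ih =>
    rw [M_succ]
    exact mul_ne_zero (mul_ne_zero (div_ne_zero two_ne_zero Real.pi_ne_zero)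
      (Real.Wallis.W_pos _).ne') ih

theorem one_sub_inv_four_mul_sq_ne_zero {k : ℕ} (hk : 1 ≤ k) :
    (1 - 1 / (4 * (k : ℝ) ^ 2)) ≠ 0 := by
  have h1 : (1 : ℝ) ≤ k := by exact_mod_cast hk
  have : 1 / (4 * (k : ℝ) ^ 2) < 1 := by
    rw [div_lt_one (by positivity)]
    nlinarith
  linarith

theorem wallis_eq_prod (n : ℕ) :
    Real.Wallis.W n = ∏ k ∈ Finset.Icc 1 n, (1 - 1 / (4 * (k : ℝ) ^ 2))⁻¹ := by
  induction n with
  | zero => simp [Real.Wallis.W]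
  | succ n ih =>
    rw [Real.Wallis.W_succ, ih, Finset.prod_Icc_succ_top (by omega)]
    congr 1
    have h1 := one_sub_inv_four_mul_sq_ne_zero (k := n + 1) (by omega)
    refine eq_inv_of_mul_eq_one_left ?_
    push_cast
    field_simp
    ring

theorem M_eq (m : ℕ) : M m = (2 / Real.pi) ^ m * ∏ k ∈ Finset.Icc 1 (2 * m - 1),
    (1 - 1 / (4 * (k : ℝ) ^ 2)) ^ (((k / 2 : ℕ) : ℤ) - (m : ℤ)) := by
  induction m with
  | zero => simp [M_zero]
  | succ m ih =>
    -- The added factors have `k / 2 = m`, hence exponent zero; the range now matches that of `W (2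
    -- * m + 1)`.
    have h1 : ∏ k ∈ Finset.Icc 1 (2 * m - 1),
        (1 - 1 / (4 * (k : ℝ) ^ 2)) ^ (((k / 2 : ℕ) : ℤ) - (m : ℤ))
        = ∏ k ∈ Finset.Icc 1 (2 * m + 1),
        (1 - 1 / (4 * (k : ℝ) ^ 2)) ^ (((k / 2 : ℕ) : ℤ) - (m : ℤ)) := by
      refine Finset.prod_subset (Finset.Icc_subset_Icc_right (by omega)) fun k hk hk' => ?_
      rw [Finset.mem_Icc] at hk hk'
      rw [show ((k / 2 : ℕ) : ℤ) - (m : ℤ) = 0 by omega, zpow_zero]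
    rw [M_succ, ih, h1, wallis_eq_prod, show 2 * (m + 1) - 1 = 2 * m + 1 by omega, pow_succ',
      mul_mul_mul_comm, ← Finset.prod_mul_distrib]
    congr 1
    refine Finset.prod_congr rfl fun k hk => ?_
    rw [← zpow_neg_one, ← zpow_add₀ (one_sub_inv_four_mul_sq_ne_zero (Finset.mem_Icc.mp hk).1)]
    congr 1
    push_cast
    ring

end ZigZagIsing

theorem mainTheorem6 :
    (∀ n : ℕ, Tendsto (ZigZagIsing.diagCorrIn n) atTop (𝓝 (ZigZagIsing.D n))) ∧
    (∀ m : ℕ, Tendsto (ZigZagIsing.magIn m) atTop (𝓝 (ZigZagIsing.M m))) ∧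
    ∀ m : ℕ,
      ZigZagIsing.M m ≠ 0 ∧ ZigZagIsing.D (2 * m + 1) ≠ 0 ∧
      ZigZagIsing.M (m + 1) / ZigZagIsing.M m
        = ZigZagIsing.D (2 * m + 2) / ZigZagIsing.D (2 * m + 1) ∧
      ZigZagIsing.M m = (2 / Real.pi) ^ m *
        ∏ k ∈ Finset.Icc 1 (2 * m - 1),
          (1 - 1 / (4 * (k : ℝ) ^ 2)) ^ (((k / 2 : ℕ) : ℤ) - (m : ℤ)) := by
  refine ⟨ZigZagIsing.tendsto_diagCorrIn, ZigZagIsing.tendsto_magIn, fun m =>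
    ⟨ZigZagIsing.M_ne_zero m, ZigZagIsing.D_ne_zero _, ?_, ZigZagIsing.M_eq m⟩⟩
  rw [ZigZagIsing.M_succ, ZigZagIsing.D_succ (2 * m + 1),
    mul_div_cancel_right₀ _ (ZigZagIsing.M_ne_zero m),
    mul_div_cancel_right₀ _ (ZigZagIsing.D_ne_zero _)]
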